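/- Let $(\mathcal S,\mathcal A,T,r,\mu)$ be a Markov decision process with finite state space $\mathcal S$, finite action space $\mathcal A$ and initial state distribution $\mu$, and let $\pi^*$, $\pi^{\mathrm{adv}}$ be two stationary policies whose induced state transition matrices $T^*(s,s')=\sum_a T(s'\mid s,a)\,\pi^*(a\mid s)$ and $T^{\mathrm{adv}}$ (defined likewise from $\pi^{\mathrm{adv}}$) are irreducible. Let $\tau^*,\tau^{\mathrm{adv}}$ be their stationary distributions, and put $\theta^*(s,s')=\tau^*(s)T^*(s,s')$ and $\theta^{\mathrm{adv}}(s,s')=\tau^{\mathrm{adv}}(s)T^{\mathrm{adv}}(s,s')$. All logarithms are to base $2$, and $\log 0=-\infty$. Let $\Delta(\mathcal S^2)$ be the set of probability distributions on $\mathcal S^2$ and $\mathcal M=\{\nu\in\Delta(\mathcal S^2):\sum_j\nu(i,j)=\sum_j\nu(j,i)\ \text{for all } i\}$ the set of shift-invariant ones. For distributions $\theta^1,\theta^2$ with state marginals $\tau^k(s)=\sum_{s'}\theta^k(s,s')$ and transition probabilities $T^k(s,s')=\theta^k(s,s')/\tau^k(s)$ let $$D_K(\theta^1,\theta^2)=\sum_s\tau^1(s)\sum_{s'}T^1(s,s')\log\frac{T^1(s,s')}{T^2(s,s')}\in\mathbb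 R\cup\{\infty\},$$ where terms with $\theta^1(s,s')=0$ are $0$ and terms with $\theta^1(s,s')>0=\theta^2(s,s')$ are $\infty$. Assume that $D_K(\theta^*,\theta^{\mathrm{adv}})<\infty$ and $D_K(\theta^{\mathrm{adv}},\theta^*)<\infty$ (equivalently, $T^*$ and $T^{\mathrm{adv}}$ have the same zero entries). For a state sequence $s^n=(s_1,\dots,s_n)$ let $P^*_n(s^n)=\mu(s_1)\prod_{t=1}^{n-1}T^*(s_t,s_{t+1})$ and let $P^{\mathrm{adv}}_n$ be defined likewise from $T^{\mathrm{adv}}$. Fix $\eta\in\mathbb R$ with $$-D_K(\theta^{\mathrm{adv}},\theta^*)\le\eta\le D_K(\theta^*,\theta^{\mathrm{adv}}).$$ The detector accepts the null hypothesis $\pi^*$ if $\frac1{n-1}\log\frac{P^*_n(s^n)}{P^{\mathrm{adv}}_n(s^n)}>\eta$, and otherwise accepts $\pi^{\mathrm{adv}}$. Let $\alpha_n$ be the $P^*_n$-probability that $\pi^{\mathrm{adv}}$ is accepted and $\beta_n$ the $P^{\mathrm{adv}}_n$-probability that $\pi^*$ is accepted. Let $$\hat{\mathcal B}=\Big\{\theta\in\Delta(\mathcal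 S^2):\ \sum_{a,b}\theta(a,b)\log\frac{T^*(a,b)}{T^{\mathrm{adv}}(a,b)}>\eta\Big\},\qquad \hat{\mathcal B}^c=\Delta(\mathcal S^2)\setminus\hat{\mathcal B},$$ where pairs with $T^*(a,b)=T^{\mathrm{adv}}(a,b)=0$ contribute $0$; these are the sets of empirical transition distributions for which the detector accepts $\pi^*$, respectively $\pi^{\mathrm{adv}}$. Then $$\lim_{n\to\infty}\frac1n\log\alpha_n=-\inf_{\theta\in\overline{\hat{\mathcal B}^c}\cap\mathcal M}D_K(\theta,\theta^*),\qquad \lim_{n\to\infty}\frac1n\log\beta_n=-\inf_{\theta\in\overline{\hat{\mathcal B}}\cap\mathcal M}D_K(\theta,\theta^{\mathrm{adv}}),$$ where the infimum of the empty set is $\infty$ and a limit may be $-\infty$. -/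

import Mathlib

/-!
Binary hypothesis testing between two stationary policies of a finite Markov decision process,
observed through its state sequence. Logarithms are in base `2`.
-/

/-- A Markov decision process with finite state space `S` and finite action space `A`. -/
structure FiniteMDP (S A : Type*) [Fintype S] [Fintype A] where
  /-- `trans s a s'` is the probability of moving from `s` to `s'` under the action `a`. -/
  trans : S → A → S → ℝ
  trans_mem : ∀ s a, trans s a ∈ stdSimplex ℝ S
  /-- The reward function. -/
  reward : S → A → ℝ
  /-- The initial state distribution. -/
  init : S → ℝ
  init_mem : init ∈ stdSimplex ℝ S

/-- A stationary (randomized) policy: `prob s a` is the probability of playing `a` in `s`. -/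
structure StationaryPolicy (S A : Type*) [Fintype A] where
  prob : S → A → ℝ
  prob_mem : ∀ s, prob s ∈ stdSimplex ℝ A

/-- The state transition matrix induced by a stationary policy. -/
def FiniteMDP.transMatrix {S A : Type*} [Fintype S] [Fintype A]
    (M : FiniteMDP S A) (π : StationaryPolicy S A) : Matrix S S ℝ :=
  Matrix.of fun s s' => ∑ a, M.trans s a s' * π.prob s a

/-- `τ` is a stationary state distribution of the transition matrix `T`. -/
def IsStationaryDist {S : Type*} [Fintype S] (T : Matrix S S ℝ) (τ : S → ℝ) : Prop :=
  τ ∈ stdSimplex ℝ S ∧ Matrix.vecMul τ T = τ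

/-- The distribution over state transitions `θ(s, s') = τ(s) T(s, s')`. -/
def transDist {S : Type*} (T : Matrix S S ℝ) (τ : S → ℝ) : S × S → ℝ :=
  fun p => τ p.1 * T p.1 p.2

/-- The set of shift-invariant probability distributions on `S × S`. -/
def shiftInvariant (S : Type*) [Fintype S] : Set (S × S → ℝ) :=
  {ν | ν ∈ stdSimplex ℝ (S × S) ∧ ∀ i, ∑ j, ν (i, j) = ∑ j, ν (j, i)}

/-- The state marginal of a distribution over transitions. -/
def stateMarginal {S : Type*} [Fintype S] (θ : S × S → ℝ) (s : S) : ℝ := ∑ j, θ (s, j)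

/-- The transition probabilities belonging to a distribution over transitions. -/
noncomputable def condTrans {S : Type*} [Fintype S] (θ : S × S → ℝ) (s s' : S) : ℝ :=
  θ (s, s') / stateMarginal θ s

open Classical in
/-- The differential divergence
`D(θ₁, θ₂) = ∑ s, τ₁(s) ∑ s', T₁(s, s') log₂ (T₁(s, s') / T₂(s, s'))`,
with the usual conventions `0 log (0 / x) = 0` and `x log (x / 0) = ∞` for `x > 0`. -/
noncomputable def diffDiv {S : Type*} [Fintype S] (θ₁ θ₂ : S × S → ℝ) : EReal :=
  ∑ s, ∑ s',
    if θ₁ (s, s') = 0 then (0 : EReal)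
    else if θ₂ (s, s') = 0 then ⊤
    else ((stateMarginal θ₁ s * (condTrans θ₁ s s' *
      Real.logb 2 (condTrans θ₁ s s' / condTrans θ₂ s s')) : ℝ) : EReal)

/-- The probability of the state sequence `s₁, …, sₙ`, `n = m + 1`, for the Markov chain with
initial distribution `μ` and transition matrix `T`. -/
def pathProb {S : Type*} (μ : S → ℝ) (T : Matrix S S ℝ) {m : ℕ} (s : Fin (m + 1) → S) : ℝ :=
  μ (s 0) * ∏ t : Fin m, T (s t.castSucc) (s t.succ)

/-- The normalized log-likelihood ratio `(1 / (n - 1)) log₂ (P₀(sⁿ) / P₁(sⁿ))`, `n = m + 1`. -/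
noncomputable def normalizedLLR {S : Type*} (μ : S → ℝ) (T₀ T₁ : Matrix S S ℝ) {m : ℕ}
    (s : Fin (m + 1) → S) : ℝ :=
  1 / (m : ℝ) * Real.logb 2 (pathProb μ T₀ s / pathProb μ T₁ s)

/-- The detector accepts the null hypothesis on the sequence `s`. -/
def acceptsNull {S : Type*} (μ : S → ℝ) (T₀ T₁ : Matrix S S ℝ) (η : ℝ) {m : ℕ}
    (s : Fin (m + 1) → S) : Prop :=
  η < normalizedLLR μ T₀ T₁ s

open Classical in
/-- The type I error probability after `n = m + 1` observed states: the probability, under the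
null hypothesis `T₀`, that the null hypothesis is not accepted. -/
noncomputable def typeIError {S : Type*} [Fintype S] (μ : S → ℝ) (T₀ T₁ : Matrix S S ℝ) (η : ℝ)
    (m : ℕ) : ℝ :=
  ∑ s : Fin (m + 1) → S with ¬ acceptsNull μ T₀ T₁ η s, pathProb μ T₀ s

open Classical in
/-- The type II error probability after `n = m + 1` observed states: the probability, under the
alternative hypothesis `T₁`, that the null hypothesis is accepted. -/
noncomputable def typeIIError {S : Type*} [Fintype S] (μ : S → ℝ) (T₀ T₁ : Matrix S S ℝ) (η : ℝ)
    (m : ℕ) : ℝ :=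
  ∑ s : Fin (m + 1) → S with acceptsNull μ T₀ T₁ η s, pathProb μ T₁ s

/-- The value of the normalized log-likelihood ratio as a function of the empirical distribution
`θ` over transitions: `∑ θ(a, b) log₂ (T₀(a, b) / T₁(a, b))`. It is used for `T₀` and `T₁` with
the same zero entries; those entries, which no trajectory of either chain uses, contribute `0`
(`Real.logb 2 (0 / 0) = 0`). -/
noncomputable def llrOfDist {S : Type*} [Fintype S] (T₀ T₁ : Matrix S S ℝ) (θ : S × S → ℝ) : ℝ :=
  ∑ p : S × S, θ p * Real.logb 2 (T₀ p.1 p.2 / T₁ p.1 p.2)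

/-- The set of distributions over transitions for which the null hypothesis is accepted. -/
def acceptRegion {S : Type*} [Fintype S] (T₀ T₁ : Matrix S S ℝ) (η : ℝ) : Set (S × S → ℝ) :=
  {θ | θ ∈ stdSimplex ℝ (S × S) ∧ η < llrOfDist T₀ T₁ θ}

/-- The complement of the acceptance region in the set of distributions over transitions. -/
def rejectRegion {S : Type*} [Fintype S] (T₀ T₁ : Matrix S S ℝ) (η : ℝ) : Set (S × S → ℝ) :=
  stdSimplex ℝ (S × S) \ acceptRegion T₀ T₁ η

open Classical in
/-- The base-2 logarithm of a probability, with `log 0 = -∞`. -/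
noncomputable def elog2 (x : ℝ) : EReal := if x = 0 then ⊥ else ((Real.logb 2 x : ℝ) : EReal)

/-!
Both errors are probabilities, under an irreducible chain `T`, of an event that is squeezed between
`{∑ₜ f(sₜ, sₜ₊₁) < m c}` and `{∑ₜ f(sₜ, sₜ₊₁) ≤ m c}`, where `f` is plus or minus the one-step
log-likelihood ratio and `c = ±η`. The common core is
`Matrix.IsIrreducible.tendsto_log_sum_pathProb_div`: such an event has the exponential rate
`min D(θ, T)` over the shift-invariant `θ ≪ T` with `f`-mean at most `c`, where `D` is the
conditional relative entropy `condRelEntropy`, a continuous function of `θ`.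

*Upper bound* (method of types). The trajectories with empirical transition distribution `θ` have
total probability at most `exp (-m D(θ, T))`, since their total probability under the transition
matrix of `θ` itself is at most one, and there are only polynomially many types
(`sum_pathProb_le_of_le_condRelEntropy`). Empirical distributions are shift-invariant up to
`O(1 / m)`, and compactness passes to the exactly shift-invariant ones.

*Lower bound* (change of measure). For `θ` shift-invariant with the same support as `T` and `f`-mean
strictly below `c`, the chain with transition distribution `θ` satisfies a weak law of large numbers
(`Matrix.IsIrreducible.eventually_deviation_le`, from the Poisson equation and Chebyshev's
inequality, so periodicity plays no role). Its typical trajectories lie in the event and have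
`T`-probability at least `exp (-m (D(θ, T) + ε))` times their own. Mixing the minimizer with one
such `θ` shows that the two bounds agree.

A `θ` of full support strictly inside the half-space exists on the whole closed range of `η`, its
endpoints included: if the two transition matrices differ, Gibbs' inequality makes the log-likelihood
ratio have different means under the two chains, and each stationary `θ` is a relatively interior
point that can be moved a little away from the other (`exists_full_support_sum_lt`). If the two
matrices coincide then `η = 0`, the null hypothesis is never accepted, and the exponents are `0` and
`-∞`.
-/

/-! ### Sums over trajectories -/

/-- The additive functional `∑ t, f (s t, s (t + 1))` of a trajectory `s`. -/
def pairSum {S : Type*} (f : S × S → ℝ) {m : ℕ} (s : Fin (m + 1) → S) : ℝ :=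
  ∑ t : Fin m, f (s t.castSucc, s t.succ)

lemma pathProb_snoc {S : Type*} (μ : S → ℝ) (Q : Matrix S S ℝ) {m : ℕ} (s : Fin (m + 1) → S)
    (b : S) :
    pathProb μ Q (Fin.snoc s b : Fin (m + 1 + 1) → S) = pathProb μ Q s * Q (s (Fin.last m)) b := by
  unfold pathProb
  rw [Fin.prod_univ_castSucc, ← mul_assoc]
  have h0 : (Fin.snoc s b : Fin (m + 1 + 1) → S) 0 = s 0 := Fin.snoc_castSucc (i := 0) ..
  simp only [Fin.snoc_castSucc, Fin.succ_last, Fin.snoc_last, h0, ← Fin.castSucc_succ]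

lemma pairSum_snoc {S : Type*} (f : S × S → ℝ) {m : ℕ} (s : Fin (m + 1) → S) (b : S) :
    pairSum f (Fin.snoc s b : Fin (m + 1 + 1) → S) = pairSum f s + f (s (Fin.last m), b) := by
  unfold pairSum
  rw [Fin.sum_univ_castSucc]
  simp only [Fin.snoc_castSucc, Fin.succ_last, Fin.snoc_last, ← Fin.castSucc_succ]

lemma sum_paths_succ {S : Type*} [Fintype S] {m : ℕ} (F : (Fin (m + 1 + 1) → S) → ℝ) :
    ∑ s, F s = ∑ s : Fin (m + 1) → S, ∑ b, F (Fin.snoc s b) := by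
  rw [← (Fin.snocEquiv fun _ : Fin (m + 1 + 1) => S).sum_comp, Fintype.sum_prod_type,
    Finset.sum_comm]
  rfl

lemma pathProb_nonneg {S : Type*} {μ : S → ℝ} {Q : Matrix S S ℝ} (hμ : ∀ a, 0 ≤ μ a)
    (hQ : ∀ a b, 0 ≤ Q a b) {m : ℕ} (s : Fin (m + 1) → S) : 0 ≤ pathProb μ Q s :=
  mul_nonneg (hμ _) (Finset.prod_nonneg fun _ _ => hQ _ _)

lemma pathProb_pos_iff {S : Type*} {μ : S → ℝ} {Q : Matrix S S ℝ} (hμ : ∀ a, 0 ≤ μ a)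
    (hQ : ∀ a b, 0 ≤ Q a b) {m : ℕ} (s : Fin (m + 1) → S) :
    0 < pathProb μ Q s ↔ 0 < μ (s 0) ∧ ∀ t : Fin m, 0 < Q (s t.castSucc) (s t.succ) := by
  rw [(pathProb_nonneg hμ hQ s).lt_iff_ne', (hμ _).lt_iff_ne']
  simp only [(hQ _ _).lt_iff_ne', pathProb, mul_ne_zero_iff, Finset.prod_ne_zero_iff,
    Finset.mem_univ, true_implies]

lemma sum_paths_zero {S : Type*} [Fintype S] (F : (Fin (0 + 1) → S) → ℝ) :
    ∑ s, F s = ∑ a, F (fun _ => a) := by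
  exact ((Equiv.funUnique (Fin 1) S).symm.sum_comp F).symm

lemma sum_pathProb_le_one {S : Type*} [Fintype S] {μ : S → ℝ} {Q : Matrix S S ℝ}
    (hμ : μ ∈ stdSimplex ℝ S) (hQ : ∀ a b, 0 ≤ Q a b) (hQ1 : ∀ a, ∑ b, Q a b ≤ 1) (m : ℕ) :
    ∑ s : Fin (m + 1) → S, pathProb μ Q s ≤ 1 := by
  induction m with
  | zero => rw [sum_paths_zero]; simp [pathProb, hμ.2]
  | succ m ih =>
    rw [sum_paths_succ]
    refine le_trans (Finset.sum_le_sum fun s _ => ?_) ih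
    simp only [pathProb_snoc, ← Finset.mul_sum]
    exact mul_le_of_le_one_right (pathProb_nonneg hμ.1 hQ s) (hQ1 _)

lemma sum_pathProb {S : Type*} [Fintype S] {μ : S → ℝ} {Q : Matrix S S ℝ}
    (hμ : μ ∈ stdSimplex ℝ S) (hQ1 : ∀ a, ∑ b, Q a b = 1) (m : ℕ) :
    ∑ s : Fin (m + 1) → S, pathProb μ Q s = 1 := by
  induction m with
  | zero => rw [sum_paths_zero]; simp [pathProb, hμ.2]
  | succ m ih =>
    rw [sum_paths_succ, ← ih]
    simp only [pathProb_snoc, ← Finset.mul_sum, hQ1, mul_one]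

/-! ### The weak law of large numbers for a finite irreducible chain -/

/-- The square of a sum of martingale increments `ξ` grows at most linearly in mean. -/
lemma sum_pathProb_mul_sq_le {S : Type*} [Fintype S] {μ : S → ℝ} {Q : Matrix S S ℝ}
    (hμ : μ ∈ stdSimplex ℝ S) (hQ : ∀ a b, 0 ≤ Q a b) (hQ1 : ∀ a, ∑ b, Q a b = 1)
    {ξ : S × S → ℝ} (hξ : ∀ a, ∑ b, Q a b * ξ (a, b) = 0) {B : ℝ} (hB : ∀ p, ξ p ^ 2 ≤ B) (m : ℕ) :
    ∑ s : Fin (m + 1) → S, pathProb μ Q s * pairSum ξ s ^ 2 ≤ m * B := by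
  induction m with
  | zero => simp [pairSum]
  | succ m ih =>
    rw [sum_paths_succ]
    have h : ∀ s : Fin (m + 1) → S,
        ∑ b, pathProb μ Q (Fin.snoc s b : Fin (m + 1 + 1) → S) *
          pairSum ξ (Fin.snoc s b : Fin (m + 1 + 1) → S) ^ 2 ≤
        pathProb μ Q s * pairSum ξ s ^ 2 + pathProb μ Q s * B := by
      intro s
      set a := s (Fin.last m)
      have e : ∑ b, pathProb μ Q (Fin.snoc s b : Fin (m + 1 + 1) → S) *
          pairSum ξ (Fin.snoc s b : Fin (m + 1 + 1) → S) ^ 2 =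
          pathProb μ Q s * (pairSum ξ s ^ 2 * ∑ b, Q a b
            + 2 * pairSum ξ s * ∑ b, Q a b * ξ (a, b) + ∑ b, Q a b * ξ (a, b) ^ 2) := by
        simp only [Finset.mul_sum, ← Finset.sum_add_distrib, pathProb_snoc, pairSum_snoc]
        refine Finset.sum_congr rfl fun b _ => ?_
        ring
      rw [e, hξ, hQ1, ← mul_add]
      refine mul_le_mul_of_nonneg_left ?_ (pathProb_nonneg hμ.1 hQ s)
      have : ∑ b, Q a b * ξ (a, b) ^ 2 ≤ ∑ b, Q a b * B :=
        Finset.sum_le_sum fun b _ => mul_le_mul_of_nonneg_left (hB _) (hQ _ _)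
      rw [← Finset.sum_mul, hQ1] at this
      linarith
    refine (Finset.sum_le_sum fun s _ => h s).trans ?_
    rw [Finset.sum_add_distrib, ← Finset.sum_mul, sum_pathProb hμ hQ1]
    push_cast
    linarith

/-- A nonempty set of states closed under possible transitions is everything. -/
lemma Matrix.IsIrreducible.forall_of_closed {S : Type*} {T : Matrix S S ℝ} (hT : T.IsIrreducible)
    {P : S → Prop} (hP : ∀ a b, 0 < T a b → P a → P b) {a : S} (ha : P a) (b : S) : P b := by
  let : Quiver S := Matrix.toQuiver T
  obtain ⟨p, -⟩ := hT.connected a b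
  induction p with
  | nil => exact ha
  | cons q e ih => exact hP _ _ e.down ih

lemma Matrix.IsIrreducible.row_pos {S : Type*} {T : Matrix S S ℝ} (hT : T.IsIrreducible) (a : S) :
    ∃ b, 0 < T a b := by
  by_contra h
  push Not at h
  let : Quiver S := Matrix.toQuiver T
  obtain ⟨p, hp⟩ := hT.connected a a
  have key : ∀ {b : S} (q : Quiver.Path a b), q.length = 0 := by
    intro b q
    induction q with
    | nil => rfl
    | cons q e ih =>
      obtain rfl := Quiver.Path.eq_of_length_zero q ih
      exact absurd e.down (h _).not_gt
  exact hp.ne' (key p)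

/-- The maximum principle: harmonic functions of an irreducible chain are constant. -/
lemma Matrix.IsIrreducible.eq_of_harmonic {S : Type*} [Fintype S] {T Q : Matrix S S ℝ}
    (hT : T.IsIrreducible) (hQ : ∀ a b, 0 ≤ Q a b) (hTQ : ∀ a b, 0 < T a b → 0 < Q a b)
    (hQ1 : ∀ a, ∑ b, Q a b = 1) {h : S → ℝ} (hh : ∀ a, ∑ b, Q a b * h b = h a) (a b : S) :
    h a = h b := by
  have : Nonempty S := ⟨a⟩
  obtain ⟨x, hx⟩ := Finite.exists_max h
  have key : ∀ y, h y = h x := by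
    refine hT.forall_of_closed (P := fun y => h y = h x) (fun y z hyz hy => ?_) rfl
    have h0 : ∑ b, Q y b * (h x - h b) = 0 := by
      simp only [mul_sub, Finset.sum_sub_distrib, ← Finset.sum_mul, hQ1, hh]
      linarith
    rw [Finset.sum_eq_zero_iff_of_nonneg
      fun b _ => mul_nonneg (hQ _ _) (sub_nonneg.2 (hx b))] at h0
    rcases mul_eq_zero.1 (h0 z (Finset.mem_univ _)) with h1 | h1
    · exact absurd h1 (hTQ _ _ hyz).ne'
    · linarith
  rw [key a, key b]

/-- The Poisson equation `h - Q h = g` is solvable for `g` of stationary mean zero: the operator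
`h ↦ h - Q h + τ(h)` is injective by the maximum principle, hence surjective, and applying `τ`
shows that `τ(h) = 0` when `τ(g) = 0`. -/
lemma Matrix.IsIrreducible.exists_poisson {S : Type*} [Fintype S] {T Q : Matrix S S ℝ}
    (hT : T.IsIrreducible) (hQ : ∀ a b, 0 ≤ Q a b) (hTQ : ∀ a b, 0 < T a b → 0 < Q a b)
    (hQ1 : ∀ a, ∑ b, Q a b = 1) {τ : S → ℝ} (hτ1 : ∑ a, τ a = 1)
    (hτ : ∀ b, ∑ a, τ a * Q a b = τ b) {g : S → ℝ} (hg : ∑ a, τ a * g a = 0) :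
    ∃ h : S → ℝ, ∀ a, h a - ∑ b, Q a b * h b = g a := by
  let L : (S → ℝ) →ₗ[ℝ] (S → ℝ) :=
    { toFun := fun h a => h a - ∑ b, Q a b * h b + ∑ b, τ b * h b
      map_add' := fun h k => by
        ext a; simp only [Pi.add_apply, mul_add, Finset.sum_add_distrib]; ring
      map_smul' := fun r h => by
        ext a
        simp only [Pi.smul_apply, smul_eq_mul, RingHom.id_apply, mul_add, mul_sub, Finset.mul_sum,
          mul_left_comm] }
  have hL : ∀ h a, L h a = h a - ∑ b, Q a b * h b + ∑ b, τ b * h b := fun _ _ => rfl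
  have hτL : ∀ h, ∑ a, τ a * L h a = ∑ b, τ b * h b := by
    intro h
    have e : ∑ a, τ a * ∑ b, Q a b * h b = ∑ b, τ b * h b := by
      simp only [Finset.mul_sum]
      rw [Finset.sum_comm]
      refine Finset.sum_congr rfl fun b _ => ?_
      simp only [← mul_assoc, ← Finset.sum_mul, hτ]
    simp only [hL, mul_add, mul_sub, Finset.sum_add_distrib, Finset.sum_sub_distrib, e,
      ← Finset.sum_mul, hτ1]
    ring
  have hinj : Function.Injective L := by
    rw [← LinearMap.ker_eq_bot, LinearMap.ker_eq_bot']
    intro h h0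
    have hτ0 : ∑ b, τ b * h b = 0 := by rw [← hτL, h0]; simp
    have hc := hT.eq_of_harmonic hQ hTQ hQ1 (h := h) fun a => by
      have := hL h a
      rw [h0, hτ0, Pi.zero_apply] at this
      linarith
    ext a
    have : ∑ b, τ b * h b = h a := by
      simp only [hc _ a, ← Finset.sum_mul, hτ1, one_mul]
    rw [Pi.zero_apply, ← this, hτ0]
  obtain ⟨h, hh⟩ := LinearMap.injective_iff_surjective.1 hinj g
  refine ⟨h, fun a => ?_⟩
  have hτ0 : ∑ b, τ b * h b = 0 := by rw [← hτL, hh, hg]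
  have := hL h a
  rw [hτ0, hh] at this
  linarith

lemma pairSum_sub_telescope {S : Type*} (h : S → ℝ) {m : ℕ} (s : Fin (m + 1) → S) :
    pairSum (fun p => h p.2 - h p.1) s = h (s (Fin.last m)) - h (s 0) := by
  have h1 := Fin.sum_univ_succ fun t : Fin (m + 1) => h (s t)
  have h2 := Fin.sum_univ_castSucc fun t : Fin (m + 1) => h (s t)
  simp only [pairSum, Finset.sum_sub_distrib]
  linarith

open Classical in
/-- One-sided weak law of large numbers, from the Poisson equation and Chebyshev's inequality. -/
lemma Matrix.IsIrreducible.eventually_deviation_le {S : Type*} [Fintype S] {T Q : Matrix S S ℝ}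
    (hT : T.IsIrreducible) (hQ : ∀ a b, 0 ≤ Q a b) (hTQ : ∀ a b, 0 < T a b → 0 < Q a b)
    (hQ1 : ∀ a, ∑ b, Q a b = 1) {μ τ : S → ℝ} (hμ : μ ∈ stdSimplex ℝ S) (hτ1 : ∑ a, τ a = 1)
    (hτ : ∀ b, ∑ a, τ a * Q a b = τ b) (f : S × S → ℝ) {c : ℝ}
    (hc : ∑ p : S × S, τ p.1 * Q p.1 p.2 * f p < c) {κ : ℝ} (hκ : 0 < κ) :
    ∀ᶠ m : ℕ in Filter.atTop,
      ∑ s : Fin (m + 1) → S with m * c ≤ pairSum f s, pathProb μ Q s ≤ κ := by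
  set f' := ∑ p : S × S, τ p.1 * Q p.1 p.2 * f p with hf'
  obtain ⟨h, hh⟩ := hT.exists_poisson hQ hTQ hQ1 hτ1 hτ
    (g := fun a => ∑ b, Q a b * f (a, b) - f') (by
      simp only [mul_sub, Finset.sum_sub_distrib, ← Finset.sum_mul, hτ1]
      simp only [hf', Fintype.sum_prod_type, Finset.mul_sum, mul_assoc, one_mul, sub_self])
  let ξ : S × S → ℝ := fun p => f p - f' + (h p.2 - h p.1)
  have hξ : ∀ a, ∑ b, Q a b * ξ (a, b) = 0 := by
    intro a
    simp only [ξ, mul_add, mul_sub, Finset.sum_add_distrib, Finset.sum_sub_distrib,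
      ← Finset.sum_mul, hQ1]
    linarith [hh a]
  have hsum : ∀ {m : ℕ} (s : Fin (m + 1) → S),
      pairSum ξ s = pairSum f s - m * f' + (h (s (Fin.last m)) - h (s 0)) := by
    intro m s
    rw [← pairSum_sub_telescope]
    simp [pairSum, ξ, Finset.sum_add_distrib, Finset.sum_sub_distrib]
  set B := ∑ p, ξ p ^ 2
  have hB : ∀ p, ξ p ^ 2 ≤ B := fun p =>
    Finset.single_le_sum (f := fun p => ξ p ^ 2) (fun _ _ => sq_nonneg _) (Finset.mem_univ p)
  have hB0 : 0 ≤ B := Finset.sum_nonneg fun _ _ => sq_nonneg _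
  set C := ∑ a, |h a|
  have hC : ∀ a, |h a| ≤ C := fun a =>
    Finset.single_le_sum (f := fun a => |h a|) (fun _ _ => abs_nonneg _) (Finset.mem_univ a)
  set δ := c - f' with hδ
  have hδ0 : 0 < δ := sub_pos.2 hc
  have ev1 : ∀ᶠ m : ℕ in Filter.atTop, 4 * C / δ ≤ m :=
    tendsto_natCast_atTop_atTop.eventually_ge_atTop _
  have ev2 : ∀ᶠ m : ℕ in Filter.atTop, 4 * B / (δ ^ 2 * κ) ≤ m :=
    tendsto_natCast_atTop_atTop.eventually_ge_atTop _
  filter_upwards [ev1, ev2, Filter.eventually_gt_atTop 0] with m h1 h2 h3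
  have hm : (0 : ℝ) < m := by exact_mod_cast h3
  rw [div_le_iff₀ hδ0] at h1
  rw [div_le_iff₀ (by positivity)] at h2
  have hbad : ∀ s : Fin (m + 1) → S, m * c ≤ pairSum f s → (m * δ / 2) ^ 2 ≤ pairSum ξ s ^ 2 := by
    intro s hs
    have a1 := abs_le.1 (hC (s (Fin.last m)))
    have a2 := abs_le.1 (hC (s 0))
    have : m * δ / 2 ≤ pairSum ξ s := by
      rw [hsum]
      have : (m : ℝ) * δ = m * c - m * f' := by rw [hδ]; ring
      linarith
    exact pow_le_pow_left₀ (by positivity) this 2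
  have hch : (m * δ / 2) ^ 2 *
      ∑ s : Fin (m + 1) → S with m * c ≤ pairSum f s, pathProb μ Q s ≤ m * B := by
    refine le_trans ?_ (sum_pathProb_mul_sq_le hμ hQ hQ1 hξ hB m)
    rw [Finset.mul_sum]
    refine le_trans (Finset.sum_le_sum fun s hs => ?_)
      (Finset.sum_le_sum_of_subset_of_nonneg (Finset.subset_univ _)
        fun s _ _ => mul_nonneg (pathProb_nonneg hμ.1 hQ s) (sq_nonneg _))
    rw [mul_comm]
    exact mul_le_mul_of_nonneg_left (hbad s (Finset.mem_filter.1 hs).2)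
      (pathProb_nonneg hμ.1 hQ s)
  have hpos : 0 < (m * δ / 2) ^ 2 := by positivity
  refine le_of_mul_le_mul_left (hch.trans ?_) hpos
  nlinarith

/-! ### Empirical transition distributions and conditional relative entropy -/

open Classical in
/-- The number of times the trajectory `s` uses the transition `p`. -/
noncomputable def pairCount {S : Type*} {m : ℕ} (s : Fin (m + 1) → S) (p : S × S) : ℕ :=
  (Finset.univ.filter fun t : Fin m => (s t.castSucc, s t.succ) = p).card

/-- The empirical transition distribution of the trajectory `s`. -/
noncomputable def empDist {S : Type*} {m : ℕ} (s : Fin (m + 1) → S) (p : S × S) : ℝ :=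
  pairCount s p / m

/-- The conditional relative entropy `∑ p, θ p log (T^θ p / T p)` of a distribution `θ` over
transitions with respect to the transition matrix `T`, in nats. It is written so that continuity
in `θ` is visible; the value is the intended one only for `θ` absolutely continuous with respect
to `T`. -/
noncomputable def condRelEntropy {S : Type*} [Fintype S] (T : Matrix S S ℝ) (θ : S × S → ℝ) : ℝ :=
  ∑ p, θ p * Real.log (θ p) - ∑ a, stateMarginal θ a * Real.log (stateMarginal θ a)
    - ∑ p : S × S, θ p * Real.log (T p.1 p.2)

lemma pairCount_le {S : Type*} {m : ℕ} (s : Fin (m + 1) → S) (p : S × S) : pairCount s p ≤ m := by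
  classical
  exact (Finset.card_filter_le _ _).trans (by simp)

lemma pairSum_eq_sum_pairCount {S : Type*} [Fintype S] (f : S × S → ℝ) {m : ℕ}
    (s : Fin (m + 1) → S) : pairSum f s = ∑ p, pairCount s p * f p := by
  classical
  unfold pairSum pairCount
  rw [← Finset.sum_fiberwise Finset.univ (fun t : Fin m => (s t.castSucc, s t.succ))]
  refine Finset.sum_congr rfl fun p _ => ?_
  rw [← nsmul_eq_mul]
  convert Finset.sum_eq_card_nsmul (s := Finset.univ.filter
    fun t : Fin m => (s t.castSucc, s t.succ) = p) (b := f p) fun t ht => ?_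
  rw [(Finset.mem_filter.1 ht).2]

lemma pairSum_eq {S : Type*} [Fintype S] (f : S × S → ℝ) {m : ℕ} (hm : 0 < m)
    (s : Fin (m + 1) → S) : pairSum f s = m * ∑ p, empDist s p * f p := by
  have : (m : ℝ) ≠ 0 := by positivity
  rw [pairSum_eq_sum_pairCount, Finset.mul_sum]
  refine Finset.sum_congr rfl fun p _ => ?_
  rw [empDist]
  field_simp

lemma empDist_mem {S : Type*} [Fintype S] {m : ℕ} (hm : 0 < m) (s : Fin (m + 1) → S) :
    empDist s ∈ stdSimplex ℝ (S × S) := by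
  refine ⟨fun p => by unfold empDist; positivity, ?_⟩
  have h := pairSum_eq (fun _ => 1) hm s
  have hm' : (m : ℝ) ≠ 0 := by positivity
  simp only [pairSum, Finset.sum_const, Finset.card_univ, Fintype.card_fin, nsmul_eq_mul,
    mul_one] at h
  exact mul_left_cancel₀ hm' (by rw [← h, mul_one])

lemma exists_of_empDist_ne_zero {S : Type*} {m : ℕ} {s : Fin (m + 1) → S} {p : S × S}
    (h : empDist s p ≠ 0) : ∃ t : Fin m, (s t.castSucc, s t.succ) = p := by
  classical
  have h1 : pairCount s p ≠ 0 := fun h0 => h (by simp [empDist, h0])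
  obtain ⟨t, ht⟩ := Finset.card_pos.1 (Nat.pos_of_ne_zero h1)
  exact ⟨t, (Finset.mem_filter.1 ht).2⟩

lemma empDist_pos {S : Type*} {m : ℕ} (s : Fin (m + 1) → S) (t : Fin m) :
    0 < empDist s (s t.castSucc, s t.succ) := by
  classical
  have hm : 0 < m := t.pos
  have : 0 < pairCount s (s t.castSucc, s t.succ) :=
    Finset.card_pos.2 ⟨t, Finset.mem_filter.2 ⟨Finset.mem_univ _, rfl⟩⟩
  unfold empDist
  positivity

lemma le_stateMarginal {S : Type*} [Fintype S] {θ : S × S → ℝ} (h0 : ∀ p, 0 ≤ θ p) (p : S × S) :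
    θ p ≤ stateMarginal θ p.1 :=
  Finset.single_le_sum (f := fun b => θ (p.1, b)) (fun _ _ => h0 _) (Finset.mem_univ p.2)

lemma stateMarginal_nonneg {S : Type*} [Fintype S] {θ : S × S → ℝ} (h0 : ∀ p, 0 ≤ θ p) (a : S) :
    0 ≤ stateMarginal θ a := Finset.sum_nonneg fun _ _ => h0 _

lemma condTrans_nonneg {S : Type*} [Fintype S] {θ : S × S → ℝ} (h0 : ∀ p, 0 ≤ θ p) (a b : S) :
    0 ≤ condTrans θ a b := div_nonneg (h0 _) (stateMarginal_nonneg h0 a)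

lemma condTrans_pos {S : Type*} [Fintype S] {θ : S × S → ℝ} (h0 : ∀ p, 0 ≤ θ p) {a b : S}
    (h : 0 < θ (a, b)) : 0 < condTrans θ a b :=
  div_pos h (h.trans_le (le_stateMarginal h0 (a, b)))

lemma sum_condTrans_le_one {S : Type*} [Fintype S] (θ : S × S → ℝ) (a : S) :
    ∑ b, condTrans θ a b ≤ 1 := by
  simp only [condTrans, ← Finset.sum_div]
  exact div_self_le_one (stateMarginal θ a)

lemma stateMarginal_mul_condTrans {S : Type*} [Fintype S] {θ : S × S → ℝ} (h0 : ∀ p, 0 ≤ θ p)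
    (p : S × S) : stateMarginal θ p.1 * condTrans θ p.1 p.2 = θ p := by
  rcases (h0 p).eq_or_lt with h | h
  · simp [condTrans, ← h]
  · exact mul_div_cancel₀ _ (h.trans_le (le_stateMarginal h0 p)).ne'

lemma sum_mul_log_condTrans_div {S : Type*} [Fintype S] {T : Matrix S S ℝ} {θ : S × S → ℝ}
    (h0 : ∀ p, 0 ≤ θ p) (hT : ∀ p : S × S, θ p ≠ 0 → T p.1 p.2 ≠ 0) :
    ∑ p : S × S, θ p * Real.log (condTrans θ p.1 p.2 / T p.1 p.2) = condRelEntropy T θ := by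
  have h1 : ∑ a, stateMarginal θ a * Real.log (stateMarginal θ a) =
      ∑ p : S × S, θ p * Real.log (stateMarginal θ p.1) := by
    rw [Fintype.sum_prod_type]
    exact Finset.sum_congr rfl fun a _ => Finset.sum_mul ..
  rw [condRelEntropy, h1, ← Finset.sum_sub_distrib, ← Finset.sum_sub_distrib]
  refine Finset.sum_congr rfl fun p _ => ?_
  rcases eq_or_ne (θ p) 0 with h | h
  · simp [h]
  · have hp : 0 < θ p := lt_of_le_of_ne (h0 p) h.symm
    have hm : stateMarginal θ p.1 ≠ 0 := (hp.trans_le (le_stateMarginal h0 p)).ne'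
    rw [condTrans, Real.log_div (div_ne_zero h hm) (hT p h), Real.log_div h hm]
    ring

lemma continuous_condRelEntropy {S : Type*} [Fintype S] (T : Matrix S S ℝ) :
    Continuous (condRelEntropy T) := by
  unfold condRelEntropy stateMarginal
  refine ((continuous_finsetSum _ fun p _ => ?_).sub (continuous_finsetSum _ fun a _ => ?_)).sub
    (by fun_prop)
  · exact Real.continuous_mul_log.comp (continuous_apply p)
  · exact Real.continuous_mul_log.comp (by fun_prop : Continuous fun θ : S × S → ℝ => ∑ j, θ (a, j))

/-- Change of measure along a trajectory possible under both `T` and `Q`. -/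
lemma pathProb_eq_mul_exp {S : Type*} (μ : S → ℝ) {T Q : Matrix S S ℝ} {m : ℕ}
    {s : Fin (m + 1) → S} (hT : ∀ t : Fin m, 0 < T (s t.castSucc) (s t.succ))
    (hQ : ∀ t : Fin m, 0 < Q (s t.castSucc) (s t.succ)) :
    pathProb μ T s = pathProb μ Q s *
      Real.exp (-pairSum (fun p => Real.log (Q p.1 p.2 / T p.1 p.2)) s) := by
  rw [pathProb, pathProb, mul_assoc, pairSum, ← Finset.sum_neg_distrib, Real.exp_sum,
    ← Finset.prod_mul_distrib]
  congr 1
  refine Finset.prod_congr rfl fun t _ => ?_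
  rw [Real.exp_neg, Real.exp_log (div_pos (hQ t) (hT t))]
  have := (hQ t).ne'
  have := (hT t).ne'
  field_simp

/-- The method of types: the trajectories of a given type `θ` have probability at most
`exp (-m D(θ, T))`, because their total probability under the transition matrix of `θ` is at most
one, and there are at most `(m + 1) ^ |S × S|` types. -/
lemma sum_pathProb_le_of_le_condRelEntropy {S : Type*} [Fintype S] {μ : S → ℝ} {T : Matrix S S ℝ}
    (hμ : μ ∈ stdSimplex ℝ S) (hT : ∀ a b, 0 ≤ T a b) {m : ℕ} (hm : 0 < m)
    (E : (Fin (m + 1) → S) → Prop) [DecidablePred E] {r : ℝ}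
    (hr : ∀ s, 0 < pathProb μ T s → E s → r ≤ condRelEntropy T (empDist s)) :
    ∑ s with E s, pathProb μ T s ≤
      ((m : ℝ) + 1) ^ Fintype.card (S × S) * Real.exp (-(m * r)) := by
  classical
  let type : (Fin (m + 1) → S) → (S × S → Fin (m + 1)) :=
    fun s p => ⟨pairCount s p, Nat.lt_succ_of_le (pairCount_le s p)⟩
  rw [← Finset.sum_fiberwise _ type]
  -- `Q` depends only on the type `k`, so the bound holds for all trajectories of that type at once.
  have key : ∀ k : S × S → Fin (m + 1),
      ∑ s with E s ∧ type s = k, pathProb μ T s ≤ Real.exp (-(m * r)) := by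
    intro k
    let θ : S × S → ℝ := fun p => ((k p : ℕ) : ℝ) / m
    have hθ0 : ∀ p, 0 ≤ θ p := fun p => by positivity
    let Q : Matrix S S ℝ := condTrans θ
    have hQ0 : ∀ a b, 0 ≤ Q a b := condTrans_nonneg hθ0
    have h1 : ∀ s : Fin (m + 1) → S, E s ∧ type s = k →
        pathProb μ T s ≤ pathProb μ Q s * Real.exp (-(m * r)) := by
      rintro s ⟨hE, rfl⟩
      rcases (pathProb_nonneg hμ.1 hT s).eq_or_lt with h | h
      · rw [← h]
        exact mul_nonneg (pathProb_nonneg hμ.1 hQ0 s) (Real.exp_pos _).le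
      · have hT' := ((pathProb_pos_iff hμ.1 hT s).1 h).2
        rw [pathProb_eq_mul_exp μ hT' (Q := Q) fun t => condTrans_pos hθ0 (empDist_pos s t)]
        refine mul_le_mul_of_nonneg_left ?_ (pathProb_nonneg hμ.1 hQ0 s)
        rw [pairSum_eq _ hm, Real.exp_le_exp, neg_le_neg_iff]
        refine mul_le_mul_of_nonneg_left ((hr s h hE).trans_eq ?_) (Nat.cast_nonneg m)
        refine (sum_mul_log_condTrans_div (empDist_mem hm s).1 fun p hp => ?_).symm
        obtain ⟨t, rfl⟩ := exists_of_empDist_ne_zero hp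
        exact (hT' t).ne'
    calc ∑ s with E s ∧ type s = k, pathProb μ T s
        ≤ ∑ s with E s ∧ type s = k, pathProb μ Q s * Real.exp (-(m * r)) :=
          Finset.sum_le_sum fun s hs => h1 s (Finset.mem_filter.1 hs).2
      _ ≤ ∑ s, pathProb μ Q s * Real.exp (-(m * r)) :=
          Finset.sum_le_sum_of_subset_of_nonneg (Finset.subset_univ _)
            fun s _ _ => mul_nonneg (pathProb_nonneg hμ.1 hQ0 s) (Real.exp_pos _).le
      _ ≤ Real.exp (-(m * r)) := by
          rw [← Finset.sum_mul]
          exact mul_le_of_le_one_left (Real.exp_pos _).le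
            (sum_pathProb_le_one hμ hQ0 (sum_condTrans_le_one θ) m)
  simp only [Finset.filter_filter]
  refine (Finset.sum_le_sum fun k _ => key k).trans_eq ?_
  rw [Finset.sum_const, nsmul_eq_mul, Finset.card_univ, Fintype.card_fun, Fintype.card_fin]
  push_cast
  rfl

/-- The total violation of shift-invariance. -/
noncomputable def shiftDefect {S : Type*} [Fintype S] (θ : S × S → ℝ) : ℝ :=
  ∑ i, |∑ j, θ (i, j) - ∑ j, θ (j, i)|

lemma shiftDefect_empDist_le {S : Type*} [Fintype S] {m : ℕ} (hm : 0 < m) (s : Fin (m + 1) → S) :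
    shiftDefect (empDist s) ≤ Fintype.card S / m := by
  classical
  have hm' : (0 : ℝ) < m := by exact_mod_cast hm
  have h : ∀ i, |∑ j, empDist s (i, j) - ∑ j, empDist s (j, i)| ≤ 1 / m := by
    intro i
    let g : S → ℝ := fun a => if a = i then -1 else 0
    have h1 := pairSum_eq (fun p => g p.2 - g p.1) hm s
    rw [pairSum_sub_telescope] at h1
    have h2 : ∑ p, empDist s p * (g p.2 - g p.1) =
        ∑ j, empDist s (i, j) - ∑ j, empDist s (j, i) := by
      simp only [mul_sub, Finset.sum_sub_distrib]
      rw [Fintype.sum_prod_type, Fintype.sum_prod_type]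
      simp [g]
      ring
    rw [h2] at h1
    rw [le_div_iff₀' hm']
    nth_rw 1 [← abs_of_pos hm']
    rw [← abs_mul, ← h1]
    simp only [g]
    split_ifs <;> norm_num
  refine (Finset.sum_le_sum fun i _ => h i).trans_eq ?_
  simp [div_eq_mul_inv]

/-- The distributions over transitions that are absolutely continuous with respect to `T` and
give `f` a mean of at most `c`. -/
def halfSimplex {S : Type*} [Fintype S] (T : Matrix S S ℝ) (f : S × S → ℝ) (c : ℝ) :
    Set (S × S → ℝ) :=
  {θ | θ ∈ stdSimplex ℝ (S × S) ∧ (∀ p : S × S, θ p ≠ 0 → T p.1 p.2 ≠ 0) ∧ ∑ p, θ p * f p ≤ c}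

lemma isCompact_halfSimplex {S : Type*} [Fintype S] (T : Matrix S S ℝ) (f : S × S → ℝ) (c : ℝ) :
    IsCompact (halfSimplex T f c) := by
  have e : halfSimplex T f c = stdSimplex ℝ (S × S) ∩
      ((⋂ p : S × S, {θ | T p.1 p.2 = 0 → θ p = 0}) ∩ {θ | ∑ p, θ p * f p ≤ c}) := by
    ext θ
    simp only [halfSimplex, Set.mem_ofPred_eq, Set.mem_inter_iff, Set.mem_iInter]
    refine and_congr_right fun _ => and_congr_left fun _ => forall_congr' fun p => ?_
    rw [not_imp_not]
  rw [e]
  refine (isCompact_stdSimplex ℝ (S × S)).inter_right (IsClosed.inter ?_ ?_)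
  · refine isClosed_iInter fun p => ?_
    by_cases h : T p.1 p.2 = 0
    · simpa [h] using isClosed_eq (continuous_apply p) continuous_const
    · simp [h]
  · exact isClosed_le (by fun_prop) continuous_const

lemma continuous_shiftDefect {S : Type*} [Fintype S] :
    Continuous (shiftDefect : (S × S → ℝ) → ℝ) := by
  unfold shiftDefect; fun_prop

lemma shiftDefect_eq_zero_iff {S : Type*} [Fintype S] {θ : S × S → ℝ} :
    shiftDefect θ = 0 ↔ ∀ i, ∑ j, θ (i, j) = ∑ j, θ (j, i) := by
  rw [shiftDefect, Finset.sum_eq_zero_iff_of_nonneg fun _ _ => abs_nonneg _]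
  simp [sub_eq_zero]

/-- An entropy bound on the shift-invariant distributions persists, by compactness, for almost
shift-invariant ones. -/
lemma exists_condRelEntropy_gt_of_shiftDefect_le {S : Type*} [Fintype S] {T : Matrix S S ℝ}
    {f : S × S → ℝ} {c r : ℝ}
    (hr : ∀ θ ∈ halfSimplex T f c ∩ shiftInvariant S, r < condRelEntropy T θ) :
    ∃ δ > 0, ∀ θ ∈ halfSimplex T f c, shiftDefect θ ≤ δ → r < condRelEntropy T θ := by
  let G := halfSimplex T f c ∩ {θ | condRelEntropy T θ ≤ r}
  have hG : IsCompact G := (isCompact_halfSimplex T f c).inter_right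
    (isClosed_le (continuous_condRelEntropy T) continuous_const)
  rcases G.eq_empty_or_nonempty with h | h
  · refine ⟨1, one_pos, fun θ hθ _ => ?_⟩
    by_contra hlt
    exact (h ▸ (⟨hθ, not_lt.1 hlt⟩ : θ ∈ G) : θ ∈ (∅ : Set _))
  · obtain ⟨x, hx, hmin⟩ := hG.exists_isMinOn h continuous_shiftDefect.continuousOn
    have hpos : 0 < shiftDefect x := by
      refine lt_of_le_of_ne (Finset.sum_nonneg fun _ _ => abs_nonneg _) fun h0 => ?_
      exact (hr x ⟨hx.1, hx.1.1, shiftDefect_eq_zero_iff.1 h0.symm⟩).not_ge hx.2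
    refine ⟨shiftDefect x / 2, half_pos hpos, fun θ hθ hd => ?_⟩
    by_contra hlt
    have : shiftDefect x ≤ shiftDefect θ := hmin (⟨hθ, not_lt.1 hlt⟩ : θ ∈ G)
    linarith

/-- The large deviations upper bound: empirical distributions are asymptotically shift-invariant,
so for large `m` the types in `E m` have entropy above `r`. -/
lemma eventually_sum_pathProb_le {S : Type*} [Fintype S] {μ : S → ℝ} {T : Matrix S S ℝ}
    (hμ : μ ∈ stdSimplex ℝ S) (hT : ∀ a b, 0 ≤ T a b) {f : S × S → ℝ} {c r : ℝ}
    (hr : ∀ θ ∈ halfSimplex T f c ∩ shiftInvariant S, r < condRelEntropy T θ)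
    (E : ∀ m : ℕ, (Fin (m + 1) → S) → Prop) [∀ m, DecidablePred (E m)]
    (hE : ∀ (m : ℕ) (s : Fin (m + 1) → S), 0 < m → 0 < pathProb μ T s →
      E m s → pairSum f s ≤ m * c) :
    ∀ᶠ m : ℕ in Filter.atTop, ∑ s with E m s, pathProb μ T s ≤
      ((m : ℝ) + 1) ^ Fintype.card (S × S) * Real.exp (-(m * r)) := by
  classical
  obtain ⟨δ, hδ, h⟩ := exists_condRelEntropy_gt_of_shiftDefect_le hr
  have ev : ∀ᶠ m : ℕ in Filter.atTop, Fintype.card S / δ ≤ (m : ℝ) :=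
    tendsto_natCast_atTop_atTop.eventually_ge_atTop _
  filter_upwards [ev, Filter.eventually_gt_atTop 0] with m h1 hm
  have hm' : (0 : ℝ) < m := by exact_mod_cast hm
  refine sum_pathProb_le_of_le_condRelEntropy hμ hT hm (E m) fun s hs hEs => ?_
  refine (h _ ⟨empDist_mem hm s, fun p hp => ?_, ?_⟩ ?_).le
  · obtain ⟨t, rfl⟩ := exists_of_empDist_ne_zero hp
    exact (((pathProb_pos_iff hμ.1 hT s).1 hs).2 t).ne'
  · have := hE m s hm hs hEs
    rw [pairSum_eq _ hm] at this
    exact le_of_mul_le_mul_left this hm'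
  · refine (shiftDefect_empDist_le hm s).trans ?_
    rw [div_le_iff₀ hδ] at h1
    rw [div_le_iff₀ hm']
    linarith

/-! ### Large deviations of an additive functional -/

/-- The large deviations lower bound: under the chain with transition distribution `θ` the
trajectories with `f`-mean below `c` and log-likelihood ratio below `r` are typical. -/
lemma eventually_le_sum_pathProb {S : Type*} [Fintype S] {μ : S → ℝ} {T : Matrix S S ℝ}
    (hμ : μ ∈ stdSimplex ℝ S) (hT : T.IsIrreducible) {f : S × S → ℝ} {c r : ℝ} {θ : S × S → ℝ}
    (hθ : θ ∈ shiftInvariant S) (hpos : ∀ p : S × S, 0 < θ p ↔ 0 < T p.1 p.2)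
    (hf : ∑ p, θ p * f p < c) (hr : condRelEntropy T θ < r)
    (E : ∀ m : ℕ, (Fin (m + 1) → S) → Prop) [∀ m, DecidablePred (E m)]
    (hE : ∀ (m : ℕ) (s : Fin (m + 1) → S), 0 < m → 0 < pathProb μ T s → pairSum f s < m * c → E m s) :
    ∀ᶠ m : ℕ in Filter.atTop,
      Real.exp (-(m * r)) / 2 ≤ ∑ s : Fin (m + 1) → S with E m s, pathProb μ T s := by
  classical
  have hθ0 := hθ.1.1
  let Q : Matrix S S ℝ := condTrans θ
  have hQ0 : ∀ a b, 0 ≤ Q a b := condTrans_nonneg hθ0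
  have hTQ : ∀ a b, 0 < T a b → 0 < Q a b := fun a b h => condTrans_pos hθ0 ((hpos (a, b)).2 h)
  have hQT : ∀ a b, 0 < Q a b → 0 < T a b := by
    intro a b h
    refine (hpos (a, b)).1 (lt_of_le_of_ne (hθ0 _) fun h0 => h.ne' ?_)
    simp [Q, condTrans, ← h0]
  have hτ0 : ∀ a, stateMarginal θ a ≠ 0 := by
    intro a
    obtain ⟨b, hb⟩ := hT.row_pos a
    exact (((hpos (a, b)).2 hb).trans_le (le_stateMarginal hθ0 (a, b))).ne'
  have hQ1 : ∀ a, ∑ b, Q a b = 1 := by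
    intro a
    simp only [Q, condTrans, ← Finset.sum_div]
    exact div_self (hτ0 a)
  have hτ1 : ∑ a, stateMarginal θ a = 1 := by
    rw [← hθ.1.2, Fintype.sum_prod_type]; rfl
  have hτ : ∀ b, ∑ a, stateMarginal θ a * Q a b = stateMarginal θ b := by
    intro b
    rw [stateMarginal, hθ.2 b]
    exact Finset.sum_congr rfl fun a _ => stateMarginal_mul_condTrans hθ0 (a, b)
  have hmean : ∀ g : S × S → ℝ,
      ∑ p : S × S, stateMarginal θ p.1 * Q p.1 p.2 * g p = ∑ p, θ p * g p := fun g =>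
    Finset.sum_congr rfl fun p _ => by rw [← stateMarginal_mul_condTrans hθ0 p]
  let g : S × S → ℝ := fun p => Real.log (Q p.1 p.2 / T p.1 p.2)
  have hg : ∑ p, θ p * g p = condRelEntropy T θ :=
    sum_mul_log_condTrans_div hθ0 fun p hp =>
      ((hpos p).1 (lt_of_le_of_ne (hθ0 p) hp.symm)).ne'
  filter_upwards [hT.eventually_deviation_le hQ0 hTQ hQ1 hμ hτ1 hτ f (c := c)
      ((hmean f).trans_lt hf) (κ := 1 / 4) (by norm_num),
    hT.eventually_deviation_le hQ0 hTQ hQ1 hμ hτ1 hτ g (c := r)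
      (((hmean g).trans hg).trans_lt hr) (κ := 1 / 4) (by norm_num),
    Filter.eventually_gt_atTop 0] with m h1 h2 hm
  set e := Real.exp (-(m * r))
  have he : 0 < e := Real.exp_pos _
  -- A trajectory outside both deviation events lies in `E m` or is impossible under `Q`.
  have hpt : ∀ s : Fin (m + 1) → S, pathProb μ Q s * e ≤
      (if E m s then pathProb μ T s else 0) + (if m * c ≤ pairSum f s then pathProb μ Q s else 0) * e
        + (if m * r ≤ pairSum g s then pathProb μ Q s else 0) * e := by
    intro s
    have hQs := pathProb_nonneg hμ.1 hQ0 s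
    have hTs := pathProb_nonneg hμ.1 hT.nonneg s
    have hQe := mul_nonneg hQs he.le
    by_cases hb1 : m * c ≤ pairSum f s
    · rw [if_pos hb1]
      split_ifs <;> linarith
    by_cases hb2 : m * r ≤ pairSum g s
    · rw [if_pos hb2]
      split_ifs <;> linarith
    rw [if_neg hb1, if_neg hb2]
    rcases hQs.eq_or_lt with h | h
    · rw [← h]; split_ifs <;> linarith
    · have hs := (pathProb_pos_iff hμ.1 hQ0 s).1 h
      have hsT : ∀ t : Fin m, 0 < T (s t.castSucc) (s t.succ) := fun t => hQT _ _ (hs.2 t)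
      have hP : 0 < pathProb μ T s := (pathProb_pos_iff hμ.1 hT.nonneg s).2 ⟨hs.1, hsT⟩
      rw [if_pos (hE m s hm hP (not_le.1 hb1)), pathProb_eq_mul_exp μ hsT hs.2, zero_mul, add_zero,
        add_zero]
      exact mul_le_mul_of_nonneg_left (Real.exp_le_exp.2 (neg_le_neg (not_le.1 hb2).le)) hQs
  have hsum := Finset.sum_le_sum fun s (_ : s ∈ Finset.univ) => hpt s
  simp only [Finset.sum_add_distrib, ← Finset.sum_mul, sum_pathProb hμ hQ1,
    ← Finset.sum_filter] at hsum
  nlinarith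

lemma tendsto_natCast_mul_div_add_one (r : ℝ) :
    Filter.Tendsto (fun m : ℕ => (m * r : ℝ) / (m + 1)) Filter.atTop (nhds r) := by
  have h := (tendsto_natCast_div_add_atTop (1 : ℝ)).mul_const r
  rw [one_mul] at h
  exact h.congr fun m => by ring

lemma tendsto_log_add_one_div_add_one :
    Filter.Tendsto (fun m : ℕ => Real.log ((m : ℝ) + 1) / (m + 1)) Filter.atTop (nhds 0) :=
  Real.isLittleO_log_id_atTop.tendsto_div_nhds_zero.comp
    (tendsto_natCast_atTop_atTop.atTop_add tendsto_const_nhds)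

/-- A full-support point of the open half-space makes the entropy bound over the open half-space
agree with the one over the closed half-space, by mixing. -/
lemma exists_full_support_condRelEntropy_lt {S : Type*} [Fintype S] {T : Matrix S S ℝ}
    (hT : ∀ a b, 0 ≤ T a b) {f : S × S → ℝ} {c r : ℝ} {θ₀ θ₁ : S × S → ℝ}
    (h₀ : θ₀ ∈ shiftInvariant S) (hpos : ∀ p : S × S, 0 < θ₀ p ↔ 0 < T p.1 p.2)
    (hf : ∑ p, θ₀ p * f p < c) (h₁ : θ₁ ∈ halfSimplex T f c ∩ shiftInvariant S)
    (hr : condRelEntropy T θ₁ < r) :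
    ∃ θ ∈ shiftInvariant S, (∀ p : S × S, 0 < θ p ↔ 0 < T p.1 p.2) ∧ ∑ p, θ p * f p < c ∧
      condRelEntropy T θ < r := by
  have hcont : Continuous fun x : ℝ => condRelEntropy T ((1 - x) • θ₁ + x • θ₀) :=
    (continuous_condRelEntropy T).comp (by fun_prop)
  have ev : ∀ᶠ x : ℝ in nhds 0, condRelEntropy T ((1 - x) • θ₁ + x • θ₀) < r :=
    hcont.continuousAt.eventually_lt_const (by simpa using hr)
  obtain ⟨x, hx, hx0, hx1⟩ := ((ev.filter_mono nhdsWithin_le_nhds).and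
    (Ioo_mem_nhdsGT (zero_lt_one' ℝ))).exists
  have hx1' : 0 < 1 - x := sub_pos.2 hx1
  have hval : ∀ p, ((1 - x) • θ₁ + x • θ₀) p = (1 - x) * θ₁ p + x * θ₀ p := fun p => rfl
  refine ⟨(1 - x) • θ₁ + x • θ₀, ⟨?_, fun i => ?_⟩, fun p => ?_, ?_, hx⟩
  · exact convex_stdSimplex ℝ (S × S) h₁.1.1 h₀.1 hx1'.le hx0.le (by ring)
  · simp only [hval, Finset.sum_add_distrib, ← Finset.mul_sum, h₀.2 i, h₁.2.2 i]
  · have a1 := h₁.1.1.1 p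
    rw [hval]
    constructor
    · intro h
      refine lt_of_le_of_ne (hT _ _) fun h0 => h.ne' ?_
      have b0 : θ₀ p = 0 := le_antisymm (not_lt.1 fun hp => ((hpos p).1 hp).ne h0) (h₀.1.1 p)
      have b1 : θ₁ p = 0 := not_not.1 fun hp => h₁.1.2.1 p hp h0.symm
      simp [b0, b1]
    · intro h
      have := mul_pos hx0 ((hpos p).2 h)
      positivity
  · simp only [hval, add_mul, mul_assoc, Finset.sum_add_distrib, ← Finset.mul_sum]
    have := h₁.1.2.2
    nlinarith

/-- The exponential rate of an event that lies between the trajectories with `f`-mean `< c` and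
those with `f`-mean `≤ c` is the minimal conditional relative entropy over the shift-invariant
distributions with `f`-mean `≤ c`. -/
theorem Matrix.IsIrreducible.tendsto_log_sum_pathProb_div {S : Type*} [Fintype S] {μ : S → ℝ}
    {T : Matrix S S ℝ} (hμ : μ ∈ stdSimplex ℝ S) (hT : T.IsIrreducible) {f : S × S → ℝ} {c : ℝ}
    {θ₀ : S × S → ℝ} (h₀ : θ₀ ∈ shiftInvariant S) (hpos : ∀ p : S × S, 0 < θ₀ p ↔ 0 < T p.1 p.2)
    (hf : ∑ p, θ₀ p * f p < c) (E : ∀ m : ℕ, (Fin (m + 1) → S) → Prop) [∀ m, DecidablePred (E m)]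
    (hE : ∀ (m : ℕ) (s : Fin (m + 1) → S), 0 < m → 0 < pathProb μ T s → pairSum f s < m * c → E m s)
    (hE' : ∀ (m : ℕ) (s : Fin (m + 1) → S), 0 < m → 0 < pathProb μ T s →
      E m s → pairSum f s ≤ m * c) :
    ∃ θ ∈ halfSimplex T f c ∩ shiftInvariant S,
      (∀ θ' ∈ halfSimplex T f c ∩ shiftInvariant S, condRelEntropy T θ ≤ condRelEntropy T θ') ∧
      (∀ᶠ m : ℕ in Filter.atTop, 0 < ∑ s : Fin (m + 1) → S with E m s, pathProb μ T s) ∧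
      Filter.Tendsto (fun m : ℕ => Real.log (∑ s with E m s, pathProb μ T s) / (m + 1))
        Filter.atTop (nhds (-condRelEntropy T θ)) := by
  classical
  have hclosed : IsClosed {θ : S × S → ℝ | ∀ i, ∑ j, θ (i, j) = ∑ j, θ (j, i)} := by
    simp only [Set.ofPred_forall]
    exact isClosed_iInter fun i => isClosed_eq (by fun_prop) (by fun_prop)
  have hcomp : IsCompact (halfSimplex T f c ∩ shiftInvariant S) := by
    have : halfSimplex T f c ∩ shiftInvariant S =
        halfSimplex T f c ∩ {θ | ∀ i, ∑ j, θ (i, j) = ∑ j, θ (j, i)} := by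
      ext θ
      exact ⟨fun h => ⟨h.1, h.2.2⟩, fun h => ⟨h.1, h.1.1, h.2⟩⟩
    rw [this]
    exact (isCompact_halfSimplex T f c).inter_right hclosed
  have hne : (halfSimplex T f c ∩ shiftInvariant S).Nonempty :=
    ⟨θ₀, ⟨h₀.1, fun p hp => ((hpos p).1 (lt_of_le_of_ne (h₀.1.1 p) hp.symm)).ne', hf.le⟩, h₀⟩
  obtain ⟨θ, hθ, hmin⟩ := hcomp.exists_isMinOn hne (continuous_condRelEntropy T).continuousOn
  have hlow : ∀ r, condRelEntropy T θ < r → ∀ᶠ m : ℕ in Filter.atTop,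
      Real.exp (-(m * r)) / 2 ≤ ∑ s : Fin (m + 1) → S with E m s, pathProb μ T s := by
    intro r hr
    obtain ⟨θ', h1, h2, h3, h4⟩ :=
      exists_full_support_condRelEntropy_lt hT.nonneg h₀ hpos hf hθ hr
    exact eventually_le_sum_pathProb hμ hT h1 h2 h3 h4 E hE
  have hposE : ∀ᶠ m : ℕ in Filter.atTop, 0 < ∑ s : Fin (m + 1) → S with E m s, pathProb μ T s :=
    (hlow _ (lt_add_one _)).mono fun m hm => lt_of_lt_of_le (by positivity) hm
  refine ⟨θ, hθ, fun θ' h => hmin h, hposE, tendsto_order.2 ⟨fun u hu => ?_, fun u hu => ?_⟩⟩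
  · obtain ⟨r, hr1, hr2⟩ := exists_between (lt_neg.1 hu)
    have hlim : Filter.Tendsto
        (fun m : ℕ => -((m * r : ℝ) / (m + 1)) - Real.log 2 * (1 / ((m : ℝ) + 1)))
        Filter.atTop (nhds (-r - Real.log 2 * 0)) :=
      (tendsto_natCast_mul_div_add_one r).neg.sub
        (tendsto_one_div_add_atTop_nhds_zero_nat.const_mul _)
    filter_upwards [hlow r hr1, hlim.eventually_const_lt (u := u) (by linarith)] with m h1 h2
    refine h2.trans_le ?_
    have h3 := Real.log_le_log (by positivity) h1
    rw [Real.log_div (Real.exp_ne_zero _) two_ne_zero, Real.log_exp] at h3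
    have hm : (0 : ℝ) < m + 1 := by positivity
    rw [le_div_iff₀ hm]
    refine le_trans (le_of_eq ?_) h3
    field_simp
  · obtain ⟨r, hr1, hr2⟩ := exists_between (neg_lt.1 hu)
    have hlim : Filter.Tendsto
        (fun m : ℕ => Fintype.card (S × S) * (Real.log ((m : ℝ) + 1) / (m + 1))
          - (m * r : ℝ) / (m + 1))
        Filter.atTop (nhds (Fintype.card (S × S) * 0 - r)) :=
      (tendsto_log_add_one_div_add_one.const_mul _).sub (tendsto_natCast_mul_div_add_one r)
    filter_upwards [eventually_sum_pathProb_le hμ hT.nonneg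
      (fun θ' h => hr2.trans_le (hmin h)) E hE', hposE,
      hlim.eventually_lt_const (u := u) (by linarith)] with m h1 h0 h2
    refine lt_of_le_of_lt ?_ h2
    have h3 := Real.log_le_log h0 h1
    have hm : (0 : ℝ) < m + 1 := by positivity
    rw [Real.log_mul (by positivity) (Real.exp_ne_zero _), Real.log_exp, Real.log_pow] at h3
    rw [div_le_iff₀ hm]
    refine h3.trans (le_of_eq ?_)
    field_simp
    ring

/-! ### The differential divergence as a conditional relative entropy -/

lemma EReal.coe_finsetSum {ι : Type*} (s : Finset ι) (f : ι → ℝ) :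
    ((∑ i ∈ s, f i : ℝ) : EReal) = ∑ i ∈ s, (f i : EReal) := by
  classical
  induction s using Finset.induction_on with
  | empty => simp
  | insert a s ha ih => rw [Finset.sum_insert ha, Finset.sum_insert ha, EReal.coe_add, ih]

lemma EReal.sum_ne_bot {ι : Type*} {s : Finset ι} {f : ι → EReal} (h : ∀ i ∈ s, f i ≠ ⊥) :
    ∑ i ∈ s, f i ≠ ⊥ := by
  classical
  induction s using Finset.induction_on with
  | empty => simp
  | insert a s ha ih =>
    rw [Finset.sum_insert ha]
    exact EReal.add_ne_bot_iff.2 ⟨h a (Finset.mem_insert_self _ _),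
      ih fun i hi => h i (Finset.mem_insert_of_mem hi)⟩

lemma EReal.sum_eq_top {ι : Type*} {s : Finset ι} {f : ι → EReal} (h : ∀ i ∈ s, f i ≠ ⊥) {i : ι}
    (hi : i ∈ s) (hf : f i = ⊤) : ∑ i ∈ s, f i = ⊤ := by
  classical
  rw [← Finset.add_sum_erase s f hi, hf]
  exact EReal.top_add_of_ne_bot (EReal.sum_ne_bot fun j hj => h j (Finset.mem_of_mem_erase hj))

lemma stateMarginal_transDist {S : Type*} [Fintype S] {T : Matrix S S ℝ}
    (hT1 : ∀ a, ∑ b, T a b = 1) (τ : S → ℝ) (a : S) : stateMarginal (transDist T τ) a = τ a := by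
  simp only [stateMarginal, transDist, ← Finset.mul_sum, hT1, mul_one]

lemma condTrans_transDist {S : Type*} [Fintype S] {T : Matrix S S ℝ}
    (hT1 : ∀ a, ∑ b, T a b = 1) {τ : S → ℝ} {a : S} (hτ : 0 < τ a) (b : S) :
    condTrans (transDist T τ) a b = T a b := by
  rw [condTrans, stateMarginal_transDist hT1, transDist, mul_div_cancel_left₀ _ hτ.ne']

lemma diffDiv_transDist_eq_coe {S : Type*} [Fintype S] {T : Matrix S S ℝ}
    (hT1 : ∀ a, ∑ b, T a b = 1) {τ : S → ℝ} (hτ : ∀ a, 0 < τ a) {θ : S × S → ℝ}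
    (h0 : ∀ p, 0 ≤ θ p) (hθ : ∀ p : S × S, θ p ≠ 0 → T p.1 p.2 ≠ 0) :
    diffDiv θ (transDist T τ) = ((condRelEntropy T θ / Real.log 2 : ℝ) : EReal) := by
  rw [← sum_mul_log_condTrans_div h0 hθ, Finset.sum_div, Fintype.sum_prod_type,
    EReal.coe_finsetSum]
  refine Finset.sum_congr rfl fun a _ => ?_
  rw [EReal.coe_finsetSum]
  refine Finset.sum_congr rfl fun b _ => ?_
  split_ifs with h1 h2
  · simp [h1]
  · exact absurd h2 (mul_ne_zero (hτ a).ne' (hθ (a, b) h1))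
  · rw [condTrans_transDist hT1 (hτ a), ← mul_assoc, stateMarginal_mul_condTrans h0 (a, b),
      Real.logb, mul_div_assoc]

lemma diffDiv_eq_top {S : Type*} [Fintype S] {θ₁ θ₂ : S × S → ℝ} {p : S × S} (h1 : θ₁ p ≠ 0)
    (h2 : θ₂ p = 0) : diffDiv θ₁ θ₂ = ⊤ := by
  have hb : ∀ s s', (if θ₁ (s, s') = 0 then (0 : EReal) else if θ₂ (s, s') = 0 then ⊤
      else ((stateMarginal θ₁ s * (condTrans θ₁ s s' *
        Real.logb 2 (condTrans θ₁ s s' / condTrans θ₂ s s')) : ℝ) : EReal)) ≠ ⊥ := by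
    intro s s'
    split_ifs
    · exact EReal.zero_ne_bot
    · exact top_ne_bot
    · exact EReal.coe_ne_bot _
  unfold diffDiv
  convert EReal.sum_eq_top (fun s _ => EReal.sum_ne_bot fun s' _ => hb s s')
    (Finset.mem_univ p.1) ?_
  exact EReal.sum_eq_top (fun s' _ => hb p.1 s') (Finset.mem_univ p.2) (by simp [h1, h2])

/-! ### Stationary distributions -/

lemma IsStationaryDist.pos {S : Type*} [Fintype S] {T : Matrix S S ℝ} (hT : T.IsIrreducible)
    {τ : S → ℝ} (hτ : IsStationaryDist T τ) (a : S) : 0 < τ a := by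
  obtain ⟨x, -, hx⟩ := Finset.exists_ne_zero_of_sum_ne_zero (hτ.1.2.trans_ne one_ne_zero)
  refine hT.forall_of_closed (P := fun a => 0 < τ a) (fun y z hyz hy => ?_)
    (lt_of_le_of_ne (hτ.1.1 x) hx.symm) a
  rw [← hτ.2]
  exact (mul_pos hy hyz).trans_le (Finset.single_le_sum (f := fun y => τ y * T y z)
    (fun i _ => mul_nonneg (hτ.1.1 i) (hT.nonneg i z)) (Finset.mem_univ y))

lemma IsStationaryDist.transDist_pos_iff {S : Type*} [Fintype S] {T : Matrix S S ℝ}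
    (hT : T.IsIrreducible) {τ : S → ℝ} (hτ : IsStationaryDist T τ) (p : S × S) :
    0 < transDist T τ p ↔ 0 < T p.1 p.2 :=
  mul_pos_iff_of_pos_left (hτ.pos hT p.1)

lemma IsStationaryDist.transDist_mem {S : Type*} [Fintype S] {T : Matrix S S ℝ}
    (hT : ∀ a b, 0 ≤ T a b) (hT1 : ∀ a, ∑ b, T a b = 1) {τ : S → ℝ} (hτ : IsStationaryDist T τ) :
    transDist T τ ∈ shiftInvariant S := by
  have hm := stateMarginal_transDist hT1 τ
  refine ⟨⟨fun p => mul_nonneg (hτ.1.1 _) (hT _ _), ?_⟩, fun i => (hm i).trans ?_⟩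
  · rw [Fintype.sum_prod_type, ← hτ.1.2]
    exact Finset.sum_congr rfl fun a _ => hm a
  · exact (congrFun hτ.2 i).symm

lemma FiniteMDP.sum_transMatrix {S A : Type*} [Fintype S] [Fintype A] (M : FiniteMDP S A)
    (π : StationaryPolicy S A) (s : S) : ∑ s', M.transMatrix π s s' = 1 := by
  simp only [FiniteMDP.transMatrix, Matrix.of_apply]
  rw [Finset.sum_comm]
  simp only [← Finset.sum_mul, (M.trans_mem s _).2, one_mul, (π.prob_mem s).2]

/-- The large deviations theorem in base `2`, with the rate as an infimum of `diffDiv`. -/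
lemma Matrix.IsIrreducible.tendsto_elog2_sum_pathProb {S : Type*} [Fintype S] {μ : S → ℝ}
    {T : Matrix S S ℝ} (hμ : μ ∈ stdSimplex ℝ S) (hT : T.IsIrreducible)
    (hT1 : ∀ a, ∑ b, T a b = 1) {τ : S → ℝ} (hτ : ∀ a, 0 < τ a) {f : S × S → ℝ} {c : ℝ}
    {θ₀ : S × S → ℝ} (h₀ : θ₀ ∈ shiftInvariant S) (hpos : ∀ p : S × S, 0 < θ₀ p ↔ 0 < T p.1 p.2)
    (hf : ∑ p, θ₀ p * f p < c) (E : ∀ m : ℕ, (Fin (m + 1) → S) → Prop) [∀ m, DecidablePred (E m)]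
    (hE : ∀ (m : ℕ) (s : Fin (m + 1) → S), 0 < m → 0 < pathProb μ T s →
      pairSum f s < m * c → E m s)
    (hE' : ∀ (m : ℕ) (s : Fin (m + 1) → S), 0 < m → 0 < pathProb μ T s →
      E m s → pairSum f s ≤ m * c)
    {R : Set (S × S → ℝ)} (hR : ∀ θ ∈ stdSimplex ℝ (S × S), θ ∈ R ↔ ∑ p, θ p * f p ≤ c) :
    Filter.Tendsto (fun m : ℕ => ((1 / ((m : ℝ) + 1) : ℝ) : EReal) *
        elog2 (∑ s : Fin (m + 1) → S with E m s, pathProb μ T s)) Filter.atTop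
      (nhds (-⨅ θ ∈ R ∩ shiftInvariant S, diffDiv θ (transDist T τ))) := by
  classical
  obtain ⟨θ, hθ, hmin, hp, hlim⟩ := hT.tendsto_log_sum_pathProb_div hμ h₀ hpos hf E hE hE'
  have hlog : 0 < Real.log 2 := Real.log_pos one_lt_two
  have hinf : ⨅ θ ∈ R ∩ shiftInvariant S, diffDiv θ (transDist T τ) =
      ((condRelEntropy T θ / Real.log 2 : ℝ) : EReal) := by
    refine le_antisymm ?_ (le_iInf₂ fun θ' hθ' => ?_)
    · refine (iInf₂_le θ ⟨(hR θ hθ.1.1).2 hθ.1.2.2, hθ.2⟩).trans_eq ?_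
      exact diffDiv_transDist_eq_coe hT1 hτ hθ.1.1.1 hθ.1.2.1
    · by_cases hac : ∀ p : S × S, θ' p ≠ 0 → T p.1 p.2 ≠ 0
      · rw [diffDiv_transDist_eq_coe hT1 hτ hθ'.2.1.1 hac, EReal.coe_le_coe_iff]
        exact div_le_div_of_nonneg_right
          (hmin θ' ⟨⟨hθ'.2.1, hac, (hR θ' hθ'.2.1).1 hθ'.1⟩, hθ'.2⟩) hlog.le
      · push Not at hac
        obtain ⟨p, h1, h2⟩ := hac
        rw [diffDiv_eq_top h1 (by rw [transDist, h2, mul_zero])]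
        exact le_top
  rw [hinf, ← EReal.coe_neg, ← neg_div]
  refine ((continuous_coe_real_ereal.tendsto _).comp
    (hlim.div_const (Real.log 2))).congr' ?_
  filter_upwards [hp] with m hm
  rw [Function.comp_apply, elog2, if_neg hm.ne', ← EReal.coe_mul, Real.logb]
  congr 1
  ring

/-! ### The log-likelihood ratio -/

lemma normalizedLLR_eq_pairSum {S : Type*} {μ : S → ℝ} {T₀ T₁ : Matrix S S ℝ} {m : ℕ}
    {s : Fin (m + 1) → S} (hμ : 0 < μ (s 0)) (h₀ : ∀ t : Fin m, 0 < T₀ (s t.castSucc) (s t.succ))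
    (h₁ : ∀ t : Fin m, 0 < T₁ (s t.castSucc) (s t.succ)) :
    normalizedLLR μ T₀ T₁ s =
      pairSum (fun p => Real.logb 2 (T₀ p.1 p.2 / T₁ p.1 p.2)) s / m := by
  have h : pathProb μ T₁ s ≠ 0 :=
    mul_ne_zero hμ.ne' (Finset.prod_ne_zero_iff.2 fun t _ => (h₁ t).ne')
  rw [normalizedLLR, pathProb_eq_mul_exp μ h₀ h₁, mul_div_cancel_left₀ _ h, Real.logb,
    Real.log_exp]
  simp only [pairSum, Real.logb, ← Finset.sum_div, ← Finset.sum_neg_distrib, ← Real.log_inv,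
    inv_div]
  ring

/-- Gibbs' inequality for transition matrices with the same zero entries, with its equality
case. -/
lemma sum_mul_log_div_pos {S : Type*} [Fintype S] {T₀ T₁ : Matrix S S ℝ}
    (hT₀ : ∀ a b, 0 ≤ T₀ a b) (hT₁ : ∀ a b, 0 ≤ T₁ a b) (h₀ : ∀ a, ∑ b, T₀ a b = 1)
    (h₁ : ∀ a, ∑ b, T₁ a b = 1) (hsupp : ∀ a b, T₀ a b = 0 ↔ T₁ a b = 0) {τ : S → ℝ}
    (hτ : ∀ a, 0 < τ a) (hne : T₀ ≠ T₁) :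
    0 < ∑ p : S × S, transDist T₀ τ p * Real.log (T₀ p.1 p.2 / T₁ p.1 p.2) := by
  have e : ∑ p : S × S, transDist T₀ τ p * Real.log (T₀ p.1 p.2 / T₁ p.1 p.2) =
      ∑ p : S × S, τ p.1 * (T₁ p.1 p.2 * InformationTheory.klFun (T₀ p.1 p.2 / T₁ p.1 p.2)) := by
    -- The correction `T₁ - T₀` turns each `T₀ log (T₀ / T₁)` into the nonnegative `T₁ klFun (T₀ / T₁)`.
    have hz : ∑ p : S × S, τ p.1 * (T₁ p.1 p.2 - T₀ p.1 p.2) = 0 := by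
      rw [Fintype.sum_prod_type]
      simp [← Finset.mul_sum, h₀, h₁]
    rw [← add_zero (∑ p : S × S, transDist T₀ τ p * _), ← hz, ← Finset.sum_add_distrib]
    refine Finset.sum_congr rfl fun p _ => ?_
    rw [transDist, InformationTheory.klFun_apply]
    rcases eq_or_ne (T₁ p.1 p.2) 0 with h | h
    · simp [h, (hsupp _ _).2 h]
    · field_simp
      ring
  have hnn : ∀ p : S × S,
      0 ≤ τ p.1 * (T₁ p.1 p.2 * InformationTheory.klFun (T₀ p.1 p.2 / T₁ p.1 p.2)) := fun p =>
    mul_nonneg (hτ _).le (mul_nonneg (hT₁ _ _)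
      (InformationTheory.klFun_nonneg (div_nonneg (hT₀ _ _) (hT₁ _ _))))
  rw [e]
  refine lt_of_le_of_ne (Finset.sum_nonneg fun p _ => hnn p) fun h => hne ?_
  ext a b
  have hab := (Finset.sum_eq_zero_iff_of_nonneg fun p _ => hnn p).1 h.symm (a, b)
    (Finset.mem_univ _)
  rcases eq_or_ne (T₁ a b) 0 with hb | hb
  · rw [hb, hsupp, hb]
  · have := (mul_eq_zero.1 ((mul_eq_zero.1 hab).resolve_left (hτ a).ne')).resolve_left hb
    rw [InformationTheory.klFun_eq_zero_iff (div_nonneg (hT₀ _ _) (hT₁ _ _))] at this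
    exact (div_eq_one_iff_eq hb).1 this

/-- A shift-invariant distribution `θ` of full support is relatively interior, so that moving away
from `θ'` makes the `f`-mean smaller than that of `θ`. -/
lemma exists_full_support_sum_lt {S : Type*} [Fintype S] {T : Matrix S S ℝ} {θ θ' : S × S → ℝ}
    (hθ : θ ∈ shiftInvariant S) (hθ' : θ' ∈ shiftInvariant S)
    (hpos : ∀ p : S × S, 0 < θ p ↔ 0 < T p.1 p.2)
    (hpos' : ∀ p : S × S, 0 < θ' p ↔ 0 < T p.1 p.2) {f : S × S → ℝ} {c : ℝ}
    (hc : ∑ p, θ p * f p ≤ c) (hlt : ∑ p, θ p * f p < ∑ p, θ' p * f p) :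
    ∃ θ₀ ∈ shiftInvariant S, (∀ p : S × S, 0 < θ₀ p ↔ 0 < T p.1 p.2) ∧ ∑ p, θ₀ p * f p < c := by
  have ev : ∀ᶠ x : ℝ in nhds 0, ∀ p : S × S, 0 < T p.1 p.2 → 0 < θ p + x * (θ p - θ' p) := by
    refine Filter.eventually_all.2 fun p => ?_
    by_cases hp : 0 < T p.1 p.2
    · have hcont : Continuous fun x : ℝ => θ p + x * (θ p - θ' p) := by fun_prop
      filter_upwards [hcont.continuousAt.eventually_const_lt (u := 0)
        (by simpa using (hpos p).2 hp)] with x hx _ using hx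
    · exact Filter.Eventually.of_forall fun x h => absurd h hp
  obtain ⟨x, hx, hx0⟩ := ((ev.filter_mono nhdsWithin_le_nhds).and
    (self_mem_nhdsWithin : Set.Ioi (0 : ℝ) ∈ nhdsWithin 0 (Set.Ioi 0))).exists
  have hx0 : 0 < x := hx0
  have hzero : ∀ p : S × S, ¬ 0 < T p.1 p.2 → θ p + x * (θ p - θ' p) = 0 := by
    intro p hp
    have h1 : θ p = 0 := le_antisymm (not_lt.1 (mt (hpos p).1 hp)) (hθ.1.1 p)
    have h2 : θ' p = 0 := le_antisymm (not_lt.1 (mt (hpos' p).1 hp)) (hθ'.1.1 p)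
    simp [h1, h2]
  refine ⟨fun p => θ p + x * (θ p - θ' p), ⟨⟨fun p => ?_, ?_⟩, fun i => ?_⟩, fun p => ⟨?_, hx p⟩,
    ?_⟩
  · by_cases hp : 0 < T p.1 p.2
    · exact (hx p hp).le
    · exact (hzero p hp).ge
  · simp only [Finset.sum_add_distrib, ← Finset.mul_sum, Finset.sum_sub_distrib, hθ.1.2, hθ'.1.2]
    ring
  · simp only [Finset.sum_add_distrib, ← Finset.mul_sum, Finset.sum_sub_distrib, hθ.2 i, hθ'.2 i]
  · intro h
    by_contra hp
    exact h.ne' (hzero p hp)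
  · simp only [add_mul, mul_assoc, sub_mul, Finset.sum_add_distrib, ← Finset.mul_sum,
      Finset.sum_sub_distrib]
    nlinarith

lemma continuous_llrOfDist {S : Type*} [Fintype S] (T₀ T₁ : Matrix S S ℝ) :
    Continuous (llrOfDist T₀ T₁) := by unfold llrOfDist; fun_prop

lemma closure_rejectRegion {S : Type*} [Fintype S] (T₀ T₁ : Matrix S S ℝ) (η : ℝ) :
    closure (rejectRegion T₀ T₁ η) = {θ | θ ∈ stdSimplex ℝ (S × S) ∧ llrOfDist T₀ T₁ θ ≤ η} := by
  have e : rejectRegion T₀ T₁ η = {θ | θ ∈ stdSimplex ℝ (S × S) ∧ llrOfDist T₀ T₁ θ ≤ η} := by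
    ext θ
    exact ⟨fun h => ⟨h.1, not_lt.1 fun hl => h.2 ⟨h.1, hl⟩⟩,
      fun h => ⟨h.1, fun hl => hl.2.not_ge h.2⟩⟩
  rw [e]
  exact ((isClosed_stdSimplex ℝ (S × S)).inter
    (isClosed_le (continuous_llrOfDist T₀ T₁) continuous_const)).closure_eq

lemma closure_acceptRegion {S : Type*} [Fintype S] {T₀ T₁ : Matrix S S ℝ} {η : ℝ}
    (hne : (acceptRegion T₀ T₁ η).Nonempty) :
    closure (acceptRegion T₀ T₁ η) = {θ | θ ∈ stdSimplex ℝ (S × S) ∧ η ≤ llrOfDist T₀ T₁ θ} := by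
  refine Set.Subset.antisymm (closure_minimal (fun θ h => ⟨h.1, h.2.le⟩)
    ((isClosed_stdSimplex ℝ (S × S)).inter
      (isClosed_le continuous_const (continuous_llrOfDist T₀ T₁)))) fun θ hθ => ?_
  obtain ⟨θ', h'⟩ := hne
  have hcont : Continuous fun x : ℝ => (1 - x) • θ + x • θ' := by fun_prop
  have hlim : Filter.Tendsto (fun x : ℝ => (1 - x) • θ + x • θ') (nhdsWithin 0 (Set.Ioi 0))
      (nhds θ) := by
    simpa using (hcont.tendsto 0).mono_left nhdsWithin_le_nhds
  refine mem_closure_of_tendsto hlim ?_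
  filter_upwards [Ioo_mem_nhdsGT (zero_lt_one' ℝ)] with x hx
  refine ⟨convex_stdSimplex ℝ (S × S) hθ.1 h'.1 (sub_pos.2 hx.2).le hx.1.le (by ring), ?_⟩
  have e : llrOfDist T₀ T₁ ((1 - x) • θ + x • θ') =
      (1 - x) * llrOfDist T₀ T₁ θ + x * llrOfDist T₀ T₁ θ' := by
    simp only [llrOfDist, Pi.add_apply, Pi.smul_apply, smul_eq_mul, add_mul, mul_assoc,
      Finset.sum_add_distrib, ← Finset.mul_sum]
  rw [e]
  nlinarith [hθ.2, h'.2, hx.1, hx.2]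

/-! ### The two error exponents -/

/-- The mean of the log-likelihood ratio under the null hypothesis is `D(θ₀, θ₁)`. -/
lemma diffDiv_transDist_transDist {S : Type*} [Fintype S] {T₀ T₁ : Matrix S S ℝ}
    (hT₀ : ∀ a b, 0 ≤ T₀ a b) (h₀ : ∀ a, ∑ b, T₀ a b = 1) (h₁ : ∀ a, ∑ b, T₁ a b = 1)
    (hsupp : ∀ a b, T₀ a b = 0 ↔ T₁ a b = 0) {τ₀ τ₁ : S → ℝ} (hτ₀ : ∀ a, 0 < τ₀ a)
    (hτ₁ : ∀ a, 0 < τ₁ a) :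
    diffDiv (transDist T₀ τ₀) (transDist T₁ τ₁) =
      ((llrOfDist T₀ T₁ (transDist T₀ τ₀) : ℝ) : EReal) := by
  have hnn : ∀ p, 0 ≤ transDist T₀ τ₀ p := fun p => mul_nonneg (hτ₀ _).le (hT₀ _ _)
  have hac : ∀ p : S × S, transDist T₀ τ₀ p ≠ 0 → T₁ p.1 p.2 ≠ 0 := fun p hp h =>
    hp (by rw [transDist, (hsupp _ _).2 h, mul_zero])
  rw [diffDiv_transDist_eq_coe h₁ hτ₁ hnn hac, ← sum_mul_log_condTrans_div hnn hac,
    Finset.sum_div]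
  congr 1
  refine Finset.sum_congr rfl fun p _ => ?_
  rw [condTrans_transDist h₀ (hτ₀ _), Real.logb, mul_div_assoc]

lemma llrOfDist_swap {S : Type*} [Fintype S] (T₀ T₁ : Matrix S S ℝ) (θ : S × S → ℝ) :
    llrOfDist T₀ T₁ θ = -llrOfDist T₁ T₀ θ := by
  simp only [llrOfDist, ← Finset.sum_neg_distrib, ← mul_neg, ← Real.logb_inv, inv_div]

lemma llrOfDist_self {S : Type*} [Fintype S] (T : Matrix S S ℝ) (θ : S × S → ℝ) :
    llrOfDist T T θ = 0 := by
  refine Finset.sum_eq_zero fun p _ => ?_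
  rcases eq_or_ne (T p.1 p.2) 0 with h | h <;> simp [h]

lemma not_acceptsNull_self {S : Type*} (μ : S → ℝ) (T : Matrix S S ℝ) {m : ℕ}
    (s : Fin (m + 1) → S) : ¬ acceptsNull μ T T 0 s := by
  rw [acceptsNull, normalizedLLR]
  rcases eq_or_ne (pathProb μ T s) 0 with h | h <;> simp [h]

lemma apply_eq_zero_of_diffDiv_lt_top {S : Type*} [Fintype S] {T₀ T₁ : Matrix S S ℝ}
    {τ₀ τ₁ : S → ℝ} (hτ₀ : ∀ a, 0 < τ₀ a)
    (h : diffDiv (transDist T₀ τ₀) (transDist T₁ τ₁) < ⊤) {a b : S} (hab : T₁ a b = 0) :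
    T₀ a b = 0 := by
  by_contra h0
  refine h.ne (diffDiv_eq_top (p := (a, b)) (mul_ne_zero (hτ₀ a).ne' h0) ?_)
  rw [transDist, hab, mul_zero]

/-- The error exponents of the likelihood ratio test between two distinct transition matrices with
the same zero entries. -/
lemma tendsto_errors_of_ne {S : Type*} [Fintype S] {μ : S → ℝ} {T₀ T₁ : Matrix S S ℝ}
    (hμ : μ ∈ stdSimplex ℝ S) (hT₀ : T₀.IsIrreducible) (hT₁ : T₁.IsIrreducible)
    (h₀ : ∀ a, ∑ b, T₀ a b = 1) (h₁ : ∀ a, ∑ b, T₁ a b = 1)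
    (hsupp : ∀ a b, T₀ a b = 0 ↔ T₁ a b = 0) (hne : T₀ ≠ T₁) {τ₀ τ₁ : S → ℝ}
    (hτ₀ : IsStationaryDist T₀ τ₀) (hτ₁ : IsStationaryDist T₁ τ₁) {η : ℝ}
    (hη : llrOfDist T₀ T₁ (transDist T₁ τ₁) ≤ η) (hη' : η ≤ llrOfDist T₀ T₁ (transDist T₀ τ₀)) :
    Filter.Tendsto
      (fun m : ℕ => ((1 / ((m : ℝ) + 1) : ℝ) : EReal) * elog2 (typeIError μ T₀ T₁ η m))
      Filter.atTop
      (nhds (-⨅ θ ∈ closure (rejectRegion T₀ T₁ η) ∩ shiftInvariant S,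
        diffDiv θ (transDist T₀ τ₀))) ∧
    Filter.Tendsto
      (fun m : ℕ => ((1 / ((m : ℝ) + 1) : ℝ) : EReal) * elog2 (typeIIError μ T₀ T₁ η m))
      Filter.atTop
      (nhds (-⨅ θ ∈ closure (acceptRegion T₀ T₁ η) ∩ shiftInvariant S,
        diffDiv θ (transDist T₁ τ₁))) := by
  classical
  have hlog : 0 < Real.log 2 := Real.log_pos one_lt_two
  have hsupp_pos : ∀ a b, 0 < T₀ a b ↔ 0 < T₁ a b := fun a b => by
    rw [(hT₀.nonneg a b).lt_iff_ne', (hT₁.nonneg a b).lt_iff_ne', ne_eq, ne_eq, hsupp]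
  have hllr_pos : 0 < llrOfDist T₀ T₁ (transDist T₀ τ₀) := by
    have := div_pos (sum_mul_log_div_pos hT₀.nonneg hT₁.nonneg h₀ h₁ hsupp (hτ₀.pos hT₀) hne) hlog
    simpa only [llrOfDist, Real.logb, mul_div_assoc, Finset.sum_div] using this
  have hllr_neg : llrOfDist T₀ T₁ (transDist T₁ τ₁) < 0 := by
    rw [llrOfDist_swap, neg_lt_zero]
    have := div_pos (sum_mul_log_div_pos hT₁.nonneg hT₀.nonneg h₁ h₀
      (fun a b => (hsupp a b).symm) (hτ₁.pos hT₁) hne.symm) hlog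
    simpa only [llrOfDist, Real.logb, mul_div_assoc, Finset.sum_div] using this
  have hm₀ := hτ₀.transDist_mem hT₀.nonneg h₀
  have hm₁ := hτ₁.transDist_mem hT₁.nonneg h₁
  have hp₀ := hτ₀.transDist_pos_iff hT₀
  have hp₁ := hτ₁.transDist_pos_iff hT₁
  let f : S × S → ℝ := fun p => Real.logb 2 (T₀ p.1 p.2 / T₁ p.1 p.2)
  have hneg : ∀ θ : S × S → ℝ, ∑ p, θ p * -f p = -llrOfDist T₀ T₁ θ := fun θ => by
    simp only [llrOfDist, mul_neg, Finset.sum_neg_distrib, f]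
  have hpair : ∀ {m : ℕ} (s : Fin (m + 1) → S), pairSum (fun p => -f p) s = -pairSum f s :=
    fun s => Finset.sum_neg_distrib ..
  have haccept : ∀ {m : ℕ} (s : Fin (m + 1) → S), 0 < m → 0 < μ (s 0) →
      (∀ t : Fin m, 0 < T₀ (s t.castSucc) (s t.succ)) →
      (acceptsNull μ T₀ T₁ η s ↔ m * η < pairSum f s) := by
    intro m s hm hs0 hs
    have hm' : (0 : ℝ) < m := by exact_mod_cast hm
    rw [acceptsNull, normalizedLLR_eq_pairSum hs0 hs fun t => (hsupp_pos _ _).1 (hs t),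
      lt_div_iff₀' hm']
  constructor
  · obtain ⟨θ, hθ, hθpos, hθlt⟩ := exists_full_support_sum_lt (f := f) hm₁ hm₀
      (fun p => (hp₁ p).trans (hsupp_pos _ _).symm) hp₀ hη (hllr_neg.trans hllr_pos)
    refine hT₀.tendsto_elog2_sum_pathProb hμ h₀ (hτ₀.pos hT₀) hθ hθpos hθlt
      (fun m s => ¬ acceptsNull μ T₀ T₁ η s) (fun m s hm hs hlt => ?_) (fun m s hm hs hE => ?_)
      fun θ hθ => ?_
    · have := (pathProb_pos_iff hμ.1 hT₀.nonneg s).1 hs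
      rw [haccept s hm this.1 this.2]
      exact hlt.not_gt
    · have := (pathProb_pos_iff hμ.1 hT₀.nonneg s).1 hs
      rw [haccept s hm this.1 this.2] at hE
      exact not_lt.1 hE
    · rw [closure_rejectRegion]
      exact and_iff_right hθ
  · obtain ⟨θ, hθ, hθpos, hθlt⟩ := exists_full_support_sum_lt (f := fun p => -f p) (c := -η) hm₀ hm₁
      (fun p => (hp₀ p).trans (hsupp_pos _ _)) hp₁ (by rw [hneg]; exact neg_le_neg hη')
      (by rw [hneg, hneg]; exact neg_lt_neg (hllr_neg.trans hllr_pos))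
    refine hT₁.tendsto_elog2_sum_pathProb hμ h₁ (hτ₁.pos hT₁) hθ hθpos hθlt
      (fun m s => acceptsNull μ T₀ T₁ η s) (fun m s hm hs hlt => ?_) (fun m s hm hs hE => ?_)
      fun θ' hθ' => ?_
    · have := (pathProb_pos_iff hμ.1 hT₁.nonneg s).1 hs
      rw [haccept s hm this.1 fun t => (hsupp_pos _ _).2 (this.2 t)]
      rw [hpair] at hlt
      linarith
    · have := (pathProb_pos_iff hμ.1 hT₁.nonneg s).1 hs
      rw [haccept s hm this.1 fun t => (hsupp_pos _ _).2 (this.2 t)] at hE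
      rw [hpair]
      linarith
    · have hmem : θ ∈ acceptRegion T₀ T₁ η := ⟨hθ.1, by rw [hneg] at hθlt; linarith⟩
      rw [closure_acceptRegion ⟨θ, hmem⟩, hneg, neg_le_neg_iff]
      exact and_iff_right hθ'

/-- The degenerate test between a transition matrix and itself, where `η = 0`: the null hypothesis
is never accepted. -/
lemma tendsto_errors_self {S : Type*} [Fintype S] {μ : S → ℝ} {T : Matrix S S ℝ}
    (hμ : μ ∈ stdSimplex ℝ S) (hT : T.IsIrreducible) (h₁ : ∀ a, ∑ b, T a b = 1) {τ τ' : S → ℝ}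
    (hτ : IsStationaryDist T τ) :
    Filter.Tendsto
      (fun m : ℕ => ((1 / ((m : ℝ) + 1) : ℝ) : EReal) * elog2 (typeIError μ T T 0 m))
      Filter.atTop
      (nhds (-⨅ θ ∈ closure (rejectRegion T T 0) ∩ shiftInvariant S,
        diffDiv θ (transDist T τ))) ∧
    Filter.Tendsto
      (fun m : ℕ => ((1 / ((m : ℝ) + 1) : ℝ) : EReal) * elog2 (typeIIError μ T T 0 m))
      Filter.atTop
      (nhds (-⨅ θ ∈ closure (acceptRegion T T 0) ∩ shiftInvariant S,
        diffDiv θ (transDist T τ'))) := by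
  classical
  constructor
  · -- The event is everything, which is also `{0 < m}` and `{0 ≤ m}`: take `f = 0` and `c = 1`.
    refine hT.tendsto_elog2_sum_pathProb hμ h₁ (hτ.pos hT) (f := 0) (c := 1)
      (hτ.transDist_mem hT.nonneg h₁) (hτ.transDist_pos_iff hT) (by simp)
      (fun m s => ¬ acceptsNull μ T T 0 s) (fun m s _ _ _ => not_acceptsNull_self μ T s)
      (fun m s _ _ _ => by simp [pairSum]) fun θ hθ => ?_
    rw [closure_rejectRegion]
    exact iff_of_true ⟨hθ, (llrOfDist_self T θ).le⟩ (by simp)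
  · have hempty : acceptRegion T T 0 = ∅ :=
      Set.eq_empty_of_forall_notMem fun θ h => (h.2.trans_eq (llrOfDist_self T θ)).false
    have hzero : ∀ m, typeIIError μ T T 0 m = 0 := fun m => by
      simp [typeIIError, not_acceptsNull_self]
    have hconst : ∀ m : ℕ, ((1 / ((m : ℝ) + 1) : ℝ) : EReal) * elog2 (typeIIError μ T T 0 m) = ⊥ :=
      fun m => by
        rw [hzero, elog2, if_pos rfl, EReal.coe_mul_bot_of_pos (by positivity)]
    simp only [hconst, hempty, closure_empty, Set.empty_inter, Set.mem_empty_iff_false,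
      iInf_false, iInf_top, EReal.neg_top]
    exact tendsto_const_nhds

theorem theorem3 {S A : Type*} [Fintype S] [Fintype A]
    (M : FiniteMDP S A) (πstar πadv : StationaryPolicy S A)
    (hstar : (M.transMatrix πstar).IsIrreducible)
    (hadv : (M.transMatrix πadv).IsIrreducible)
    (τstar τadv : S → ℝ)
    (hτstar : IsStationaryDist (M.transMatrix πstar) τstar)
    (hτadv : IsStationaryDist (M.transMatrix πadv) τadv)
    (θstar θadv : S × S → ℝ)
    (hθstar : θstar = transDist (M.transMatrix πstar) τstar)
    (hθadv : θadv = transDist (M.transMatrix πadv) τadv)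
    (hfin : diffDiv θstar θadv < ⊤) (hfin' : diffDiv θadv θstar < ⊤)
    (η : ℝ) (hη : -diffDiv θadv θstar ≤ (η : EReal)) (hη' : (η : EReal) ≤ diffDiv θstar θadv) :
    Filter.Tendsto
      (fun m : ℕ => ((1 / ((m : ℝ) + 1) : ℝ) : EReal) *
        elog2 (typeIError M.init (M.transMatrix πstar) (M.transMatrix πadv) η m))
      Filter.atTop
      (nhds (-⨅ θ ∈ closure (rejectRegion (M.transMatrix πstar) (M.transMatrix πadv) η) ∩
        shiftInvariant S, diffDiv θ θstar)) ∧
    Filter.Tendsto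
      (fun m : ℕ => ((1 / ((m : ℝ) + 1) : ℝ) : EReal) *
        elog2 (typeIIError M.init (M.transMatrix πstar) (M.transMatrix πadv) η m))
      Filter.atTop
      (nhds (-⨅ θ ∈ closure (acceptRegion (M.transMatrix πstar) (M.transMatrix πadv) η) ∩
        shiftInvariant S, diffDiv θ θadv)) := by

  subst hθstar hθadv
  have hτ₀ := hτstar.pos hstar
  have hτ₁ := hτadv.pos hadv
  have h₀ := M.sum_transMatrix πstar
  have h₁ := M.sum_transMatrix πadv
  have hsupp : ∀ a b, M.transMatrix πstar a b = 0 ↔ M.transMatrix πadv a b = 0 := fun a b =>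
    ⟨apply_eq_zero_of_diffDiv_lt_top hτ₁ hfin', apply_eq_zero_of_diffDiv_lt_top hτ₀ hfin⟩
  rw [diffDiv_transDist_transDist hadv.nonneg h₁ h₀ (fun a b => (hsupp a b).symm) hτ₁ hτ₀,
    ← EReal.coe_neg, ← llrOfDist_swap, EReal.coe_le_coe_iff] at hη
  rw [diffDiv_transDist_transDist hstar.nonneg h₀ h₁ hsupp hτ₀ hτ₁, EReal.coe_le_coe_iff] at hη'
  by_cases hne : M.transMatrix πstar = M.transMatrix πadv
  · rw [← hne] at hη hη' ⊢
    rw [llrOfDist_self] at hη hη'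
    obtain rfl := le_antisymm hη' hη
    exact tendsto_errors_self M.init_mem hstar h₀ hτstar
  · exact tendsto_errors_of_ne M.init_mem hstar hadv h₀ h₁ hsupp hne hτstar hτadv hη hη'
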